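/- Let $d\ge 0$, $n=(n_1,\dots,n_d)$, $r=(r_1,\dots,r_d)$, and equip $\mathbb R^{n_1\times\dots\times n_d}$ with the Frobenius inner product. For a tensor $\mathbf A$ let $A_{(i)}\in\mathbb R^{n_i\times\prod_{j\ne i}n_j}$ be its mode-$i$ matricization, let $\mathbf A\times_i M$ be the $i$-mode product, defined by $(\mathbf A\times_i M)_{(i)}=MA_{(i)}$, and let $\mathcal M_r$ be the submanifold of all $\mathbf X$ with $\operatorname{rank}X_{(i)}=r_i$ for all $i$. For $\mathbf X\in\mathcal M_r$ let $P_{\mathbf X}$ be the orthogonal projection of $\mathbb R^{n_1\times\dots\times n_d}$ onto the tangent space $T_{\mathbf X}\mathcal M_r$, let $P_{\mathbf X}^\perp=\mathrm{id}-P_{\mathbf X}$, and let $D_\xi P_{\mathbf X}$ be the derivative at $\mathbf X$, along $\mathcal M_r$ in the direction $\xi\in T_{\mathbf X}\mathcal M_r$, of the operator-valued map $\mathbf Y\mapsto P_{\mathbf Y}$. Write $M^+$ for the Moore–Penrose pseudoinverse of $M$. Let $\mathbf X=\mathbf C\times_1U_1\cdots\times_dU_d\in\mathcal M_r$ with $\mathbf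 C\in\mathbb R^{r_1\times\dots\times r_d}$, $U_i\in\mathbb R^{n_i\times r_i}$ and $U_i^{\mathsf T}U_i=I$. Then $\mathbf Y\mapsto P_{\mathbf Y}$ is differentiable at $\mathbf X$ along $\mathcal M_r$, and the following hold. (1) Let $\dot{\mathbf C}\in\mathbb R^{r_1\times\dots\times r_d}$ and $\dot U_i\in\mathbb R^{n_i\times r_i}$ with $\dot U_i^{\mathsf T}U_i=0$. Then $$\xi=\dot{\mathbf C}\bigtimes_{i=1}^d U_i+\sum_{i=1}^d\mathbf C\times_i\dot U_i\bigtimes_{j\ne i}U_j$$ lies in $T_{\mathbf X}\mathcal M_r$, and for every $\mathbf E\in\mathbb R^{n_1\times\dots\times n_d}$ $$P_{\mathbf X}\,(D_\xi P_{\mathbf X})\,P_{\mathbf X}^\perp\mathbf E=\widetilde{\mathbf C}\bigtimes_{i=1}^d U_i+\sum_{i=1}^d\mathbf C\times_i\widetilde U_i\bigtimes_{j\ne i}U_j\in T_{\mathbf X}\mathcal M_r,$$ where $$\widetilde{\mathbf C}=\sum_{j=1}^d\Big(\mathbf E\times_j\dot U_j^{\mathsf T}\bigtimes_{k\ne j}U_k^{\mathsf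 T}-\mathbf C\times_j\Big(\dot U_j^{\mathsf T}\big[\mathbf E\bigtimes_{k\ne j}U_k^{\mathsf T}\big]_{(j)}C_{(j)}^+\Big)\Big),$$ $$\widetilde U_i=(I-U_iU_i^{\mathsf T})\Big(\big[\mathbf E\bigtimes_{j\ne i}U_j^{\mathsf T}\big]_{(i)}\big(I-C_{(i)}^+C_{(i)}\big)\dot C_{(i)}^{\mathsf T}\big(C_{(i)}^{+}\big)^{\mathsf T}+\sum_{k\ne i}\big[\mathbf E\times_k\dot U_k^{\mathsf T}\bigtimes_{k\ne j\ne i}U_j^{\mathsf T}\big]_{(i)}\Big)C_{(i)}^+ .$$ (2) Let $P_\Omega$ be a linear orthogonal projection of $\mathbb R^{n_1\times\dots\times n_d}$ (for example the sampling operator of an index set $\Omega$, which keeps the entries with index in $\Omega$ and sets all others to $0$), let $\mathbf A\in\mathbb R^{n_1\times\dots\times n_d}$, and let $f:\mathcal M_r\to\mathbb R$, $f(\mathbf Y)=\tfrac12\|P_\Omega\mathbf Y-P_\Omega\mathbf A\|^2$. Then $f$ and its Riemannian gradient field are differentiable at $\mathbf X$ along $\mathcal M_r$, and for every $\xi\in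 T_{\mathbf X}\mathcal M_r$ the Riemannian Hessian $\operatorname{Hess}f(\mathbf X)[\xi]=P_{\mathbf X}\big(D\operatorname{grad}f(\mathbf X)[\xi]\big)$ is $$\operatorname{Hess}f(\mathbf X)[\xi]=P_{\mathbf X}P_\Omega\,\xi+P_{\mathbf X}\,(D_\xi P_{\mathbf X})\,P_{\mathbf X}^\perp\big(P_\Omega\mathbf X-P_\Omega\mathbf A\big).$$ -/

import Mathlib

open scoped ContDiff Topology

noncomputable section

namespace LowRankTucker

/-! ### Submanifolds of a Euclidean space: tangent spaces, projections, gradient, Hessian -/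

section Submanifold

variable {E : Type*} [NormedAddCommGroup E] [InnerProductSpace ℝ E] [FiniteDimensional ℝ E]

/-- The tangent space at `x` of a subset `M` (in practice, an embedded submanifold) of a Euclidean
space: the velocities at time `0` of the smooth curves that pass through `x` at time `0` and stay
in `M` for small times. (For an embedded submanifold this set of velocities is already a linear
space; the span only provides the bundled subspace.) -/
def tangentSpace (M : Set E) (x : E) : Submodule ℝ E :=
  Submodule.span ℝ {v | ∃ γ : ℝ → E, ContDiff ℝ ∞ γ ∧ (∀ᶠ t in 𝓝 (0 : ℝ), γ t ∈ M) ∧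
    γ 0 = x ∧ HasDerivAt γ v 0}

/-- The orthogonal projection `P_x` of the ambient Euclidean space onto the tangent space at `x`,
as an operator of the ambient space. -/
def tangentProj (M : Set E) (x : E) : E →L[ℝ] E :=
  (tangentSpace M x).starProjection

/-- The Riemannian gradient at `x` of the restriction of `f` to `M` (with the metric induced from
the ambient space): the tangent vector `g` with `⟪g, v⟫ = D f(x)[v]` for all tangent vectors `v`.
The derivative is taken within `M`, so only the values of `f` on `M` matter when `x ∈ M`. -/
def riemGrad (M : Set E) (f : E → ℝ) (x : E) : E :=
  ((InnerProductSpace.toDual ℝ (tangentSpace M x)).symm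
    ((fderivWithin ℝ f M x).comp (tangentSpace M x).subtypeL) : tangentSpace M x)

/-- The Riemannian Hessian at `x` of the restriction of `f` to `M`, applied to a tangent vector
`ξ`: the covariant derivative of the gradient field along `ξ`. The Riemannian connection of a
submanifold of a Euclidean space is the tangential projection of the directional derivative. -/
def riemHess (M : Set E) (f : E → ℝ) (x ξ : E) : E :=
  tangentProj M x (fderivWithin ℝ (riemGrad M f) M x ξ)

end Submanifold

/-! ### The Moore-Penrose pseudoinverse -/

section PseudoInverse

variable {α β : Type*} [Fintype α] [Fintype β]

/-- The four Penrose equations: `B` is the Moore-Penrose pseudoinverse of the real matrix `A`. -/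
structure IsMoorePenrose (A : Matrix α β ℝ) (B : Matrix β α ℝ) : Prop where
  mul_mul_left : A * B * A = A
  mul_mul_right : B * A * B = B
  symm_left : (A * B).transpose = A * B
  symm_right : (B * A).transpose = B * A

open Classical in
/-- The Moore-Penrose pseudoinverse `A⁺` of a real matrix. -/
def pinv (A : Matrix α β ℝ) : Matrix β α ℝ :=
  if h : ∃ B, IsMoorePenrose A B then Classical.choose h else 0

theorem IsMoorePenrose.unique {A : Matrix α β ℝ} {B B' : Matrix β α ℝ}
    (h : IsMoorePenrose A B) (h' : IsMoorePenrose A B') : B = B' := by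
  have e1 : A * B = A * B' := by
    calc A * B = (A * B).transpose := h.symm_left.symm
      _ = ((A * B') * (A * B)).transpose := by
          rw [← Matrix.mul_assoc, h'.mul_mul_left]
      _ = (A * B) * (A * B') := by rw [Matrix.transpose_mul, h.symm_left, h'.symm_left]
      _ = A * B' := by rw [← Matrix.mul_assoc, h.mul_mul_left]
  have e2 : B * A = B' * A := by
    calc B * A = (B * A).transpose := h.symm_right.symm
      _ = ((B * A) * (B' * A)).transpose := by
          rw [Matrix.mul_assoc, ← Matrix.mul_assoc A B' A, h'.mul_mul_left]
      _ = (B' * A) * (B * A) := by rw [Matrix.transpose_mul, h.symm_right, h'.symm_right]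
      _ = B' * A := by rw [Matrix.mul_assoc, ← Matrix.mul_assoc A B A, h.mul_mul_left]
  calc B = B * A * B := h.mul_mul_right.symm
    _ = B' * (A * B) := by rw [e2, Matrix.mul_assoc]
    _ = B' * A * B' := by rw [e1, Matrix.mul_assoc]
    _ = B' := h'.mul_mul_right

theorem pinv_eq {A : Matrix α β ℝ} {B : Matrix β α ℝ} (h : IsMoorePenrose A B) :
    pinv A = B := by
  have hex : ∃ B, IsMoorePenrose A B := ⟨B, h⟩
  unfold pinv
  rw [dif_pos hex]
  exact (Classical.choose_spec hex).unique h

/-- A matrix of full row rank has the pseudoinverse `Aᵀ (A Aᵀ)⁻¹`. -/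
theorem pinv_of_isUnit_det [DecidableEq α] {A : Matrix α β ℝ}
    (h : IsUnit (A * A.transpose).det) :
    pinv A = A.transpose * (A * A.transpose)⁻¹ := by
  have h1 : A * (A.transpose * (A * A.transpose)⁻¹) = 1 := by
    rw [← Matrix.mul_assoc, Matrix.mul_nonsing_inv _ h]
  apply pinv_eq
  refine ⟨by rw [h1, Matrix.one_mul], by rw [Matrix.mul_assoc, h1, Matrix.mul_one],
    by rw [h1, Matrix.transpose_one], ?_⟩
  simp only [Matrix.transpose_mul, Matrix.transpose_transpose, Matrix.transpose_nonsing_inv,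
    Matrix.mul_assoc]

end PseudoInverse

/-! ### Tensors -/

section Tensors

variable {d : ℕ}

/-- Real tensors of size `n 0 × ⋯ × n (d - 1)`, with the Frobenius inner product and norm. -/
abbrev Tensor (n : Fin d → ℕ) : Type := EuclideanSpace ℝ ((i : Fin d) → Fin (n i))

/-- The column indices of the mode-`i` matricization: multi-indices of the other modes. -/
abbrev OtherIdx (n : Fin d → ℕ) (i : Fin d) : Type := (j : {j : Fin d // j ≠ i}) → Fin (n j)

/-- The mode-`i` matricization `A_(i)`. -/
def matricize {n : Fin d → ℕ} (i : Fin d) (A : Tensor n) :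
    Matrix (Fin (n i)) (OtherIdx n i) ℝ :=
  Matrix.of fun a c => A ((Equiv.piSplitAt i fun j => Fin (n j)).symm (a, c))

/-- The multilinear rank `(rank A_(1), …, rank A_(d))`. -/
def multilinearRank {n : Fin d → ℕ} (A : Tensor n) : Fin d → ℕ := fun i => (matricize i A).rank

/-- The manifold `M_r` of the tensors of size `n` with multilinear rank `r`. -/
def fixedRank (n r : Fin d → ℕ) : Set (Tensor n) := {X | multilinearRank X = r}

/-- The simultaneous mode products `A ×₁ M₁ ×₂ M₂ ⋯ ×_d M_d`. -/
def multiProd {n m : Fin d → ℕ} (A : Tensor n)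
    (M : (i : Fin d) → Matrix (Fin (m i)) (Fin (n i)) ℝ) : Tensor m :=
  WithLp.toLp 2 fun k => ∑ l : (i : Fin d) → Fin (n i), (∏ i, M i (k i) (l i)) * A l

/-- A single mode product `A ×_i N` with a square matrix. -/
def modeProd {n : Fin d → ℕ} (A : Tensor n) (i : Fin d) (N : Matrix (Fin (n i)) (Fin (n i)) ℝ) :
    Tensor n :=
  multiProd A (Function.update (fun j => (1 : Matrix (Fin (n j)) (Fin (n j)) ℝ)) i N)

/-- The Kronecker product of the matrices `M_j` for `j ≠ i`. -/
def kronOthers {n m : Fin d → ℕ} (i : Fin d)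
    (M : (j : Fin d) → Matrix (Fin (m j)) (Fin (n j)) ℝ) :
    Matrix (OtherIdx m i) (OtherIdx n i) ℝ :=
  Matrix.of fun c b => ∏ j : {j : Fin d // j ≠ i}, M j (c j) (b j)

/-- The mode-`i` matricization `[A ×_{j ≠ i} M_j]_(i)` of the product of `A` with the matrices
`M_j` in all the modes `j ≠ i`; mode `i` is left alone, and `M i` is not used. -/
def matricizeOthers {n m : Fin d → ℕ} (i : Fin d) (A : Tensor n)
    (M : (j : Fin d) → Matrix (Fin (m j)) (Fin (n j)) ℝ) :
    Matrix (Fin (n i)) (OtherIdx m i) ℝ :=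
  matricize i A * (kronOthers i M).transpose

/-- Compatibility of the two kinds of products:
`[A ×₁ M₁ ⋯ ×_d M_d]_(i) = M_i [A ×_{j ≠ i} M_j]_(i)`. -/
theorem matricize_multiProd {n m : Fin d → ℕ} (i : Fin d) (A : Tensor n)
    (M : (j : Fin d) → Matrix (Fin (m j)) (Fin (n j)) ℝ) :
    matricize i (multiProd A M) = M i * matricizeOthers i A M := by
  have hsymm : ∀ (p : Fin d → ℕ) (a : Fin (p i)) (c : OtherIdx p i),
      ((Equiv.piSplitAt i fun j => Fin (p j)).symm (a, c)) i = a := by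
    intro p a c; simp [Equiv.piSplitAt]
  have hsymm' : ∀ (p : Fin d → ℕ) (a : Fin (p i)) (c : OtherIdx p i) (j : {j // j ≠ i}),
      ((Equiv.piSplitAt i fun j => Fin (p j)).symm (a, c)) j = c j := by
    intro p a c j; simp [Equiv.piSplitAt, j.2]
  ext a c
  simp only [matricize, multiProd, matricizeOthers, kronOthers, Matrix.mul_apply, Matrix.of_apply,
    Matrix.transpose_apply]
  rw [← (Equiv.piSplitAt i fun j => Fin (n j)).symm.sum_comp, Fintype.sum_prod_type]
  refine Finset.sum_congr rfl fun a' _ => ?_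
  rw [Finset.mul_sum]
  refine Finset.sum_congr rfl fun b _ => ?_
  rw [Fintype.prod_eq_mul_prod_subtype_ne _ i]
  simp only [hsymm, hsymm']
  ring

/-- The tensor `Ċ ×₁ U₁ ⋯ ×_d U_d + ∑ i, C ×_i U̇_i ×_{j ≠ i} U_j` that is given by the variations
`C'` of the core tensor and `U'` of the basis matrices. -/
def variation {n r : Fin d → ℕ} (C : Tensor r) (U : (i : Fin d) → Matrix (Fin (n i)) (Fin (r i)) ℝ)
    (C' : Tensor r) (U' : (i : Fin d) → Matrix (Fin (n i)) (Fin (r i)) ℝ) : Tensor n :=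
  multiProd C' U + ∑ i, multiProd C (Function.update U i (U' i))

/-- The core variation `C̃` of the curvature term. -/
def curvatureCore {n r : Fin d → ℕ} (C : Tensor r)
    (U U' : (i : Fin d) → Matrix (Fin (n i)) (Fin (r i)) ℝ) (E : Tensor n) : Tensor r :=
  ∑ j, (multiProd E (Function.update (fun k => (U k).transpose) j (U' j).transpose)
    - modeProd C j ((U' j).transpose * matricizeOthers j E (fun k => (U k).transpose)
        * pinv (matricize j C)))

/-- The basis variation `Ũ_i` of the curvature term. -/
def curvatureBasis {n r : Fin d → ℕ} (C : Tensor r)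
    (U : (i : Fin d) → Matrix (Fin (n i)) (Fin (r i)) ℝ)
    (C' : Tensor r) (U' : (i : Fin d) → Matrix (Fin (n i)) (Fin (r i)) ℝ) (E : Tensor n)
    (i : Fin d) : Matrix (Fin (n i)) (Fin (r i)) ℝ :=
  (1 - U i * (U i).transpose) *
    (matricizeOthers i E (fun j => (U j).transpose)
        * (1 - pinv (matricize i C) * matricize i C)
        * (matricize i C').transpose * (pinv (matricize i C)).transpose
      + ∑ k ∈ Finset.univ.erase i, matricizeOthers i E
          (Function.update (fun j => (U j).transpose) k (U' k).transpose))
    * pinv (matricize i C)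

/-- The tensor completion cost function `½ ‖P X - P A‖²`. -/
def completionCost {n : Fin d → ℕ} (P : Tensor n →ₗ[ℝ] Tensor n) (A X : Tensor n) : ℝ :=
  1 / 2 * ‖P X - P A‖ ^ 2

open Classical in
/-- The sampling operator of a set `Ω` of multi-indices: it keeps the entries with index in `Ω` and
replaces all other entries by `0`. -/
def sampling {n : Fin d → ℕ} (Ω : Set ((i : Fin d) → Fin (n i))) : Tensor n →ₗ[ℝ] Tensor n where
  toFun X := WithLp.toLp 2 fun k => if k ∈ Ω then X k else 0
  map_add' X Y := by
    ext k
    by_cases h : k ∈ Ω <;> simp [h]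
  map_smul' c X := by
    ext k
    by_cases h : k ∈ Ω <;> simp [h]

/-- Sampling operators are orthogonal projections. -/
theorem sampling_isSymmetricProjection {n : Fin d → ℕ} (Ω : Set ((i : Fin d) → Fin (n i))) :
    (sampling Ω).IsSymmetricProjection where
  isIdempotentElem := by
    ext X k
    by_cases h : k ∈ Ω <;> simp [sampling, h]
  isSymmetric X Y := by
    simp only [sampling, LinearMap.coe_mk, AddHom.coe_mk, PiLp.inner_apply]
    refine Finset.sum_congr rfl fun k _ => ?_
    by_cases h : k ∈ Ω <;> simp [h]

end Tensors

end LowRankTucker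

end

open LowRankTucker

open scoped ContDiff Topology

noncomputable section

namespace LowRankTucker

/-! ### Multilinear algebra of mode products, matricizations and the parametrization of tangent
vectors. -/

section Algebra

open Matrix

variable {d : ℕ} {n m p : Fin d → ℕ}

/-! The curvature term is computed by duality. If `γ` is a curve in the manifold with velocity `ξ`,
`η` a tangent field along it and `Z` a normal vector at `X`, then `⟪P_γ Z, η⟫ = ⟪Z, η⟫` for small
times. Differentiating at `0` gives `⟪P (D_ξ P) Z, η 0⟫ = ⟪Z, η' 0⟫`
(`inner_tangentProj_fderivWithin`).

For `γ` take the straight line `(C + t C', U + t U')` in the parameters, and for `η` the tangent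
vector with frozen coordinates `(D, V)` along it. Then `η' 0` is a mixed second derivative of the
multilinear parametrization (`hasDerivAt_variation_line`). With the explicit projection `variationL
C U ∘ tangentCoord C U`, its pairing with the normal part of `E` can be evaluated by traces of
matricizations, and it equals the pairing of the claimed vector with `variation C U D V`
(`inner_variation_curvature`). Both candidates are tangent, so agreeing against all tangent vectors
makes them equal.

Differentiability of `Y ↦ P_Y` needs a local description of the manifold. Near `X` a tensor `Y` of
rank `r` is recovered smoothly from its core `multiProd Y Uᵀ` and its normalized frames
(`multiProd_normalizedFrame`). This yields the tangent spaces (`tangentSpace_eq_range`) and a smooth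
family of operators `S Y` with range `T_Y` and `S X = P_X`. The formula `P_Y = S (S† S + 1 - P_X)⁻¹
S†` is then differentiable (`starProjection_range_eq`, `differentiableWithinAt_tangentProj`).

For the Hessian, the gradient field is `P_Y` applied to the ambient gradient. The product rule gives
two terms, and `P (D_ξ P) P = 0` removes the tangential part of the second
(`tangentProj_fderivWithin_tangentProj`). -/

theorem multiProd_apply (A : Tensor n) (M : (i : Fin d) → Matrix (Fin (m i)) (Fin (n i)) ℝ)
    (k : (i : Fin d) → Fin (m i)) :
    multiProd A M k = ∑ l : (i : Fin d) → Fin (n i), (∏ i, M i (k i) (l i)) * A l := rfl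

/-- Isolates the only factor that depends on `N`; linearity in a single mode and the product rule
both rest on it. -/
theorem prod_update_entry (M : (i : Fin d) → Matrix (Fin (m i)) (Fin (n i)) ℝ) (i : Fin d)
    (N : Matrix (Fin (m i)) (Fin (n i)) ℝ) (k : (i : Fin d) → Fin (m i))
    (l : (i : Fin d) → Fin (n i)) :
    ∏ j, Function.update M i N j (k j) (l j)
      = N (k i) (l i) * ∏ j ∈ Finset.univ.erase i, M j (k j) (l j) := by
  rw [← Finset.mul_prod_erase _ _ (Finset.mem_univ i), Function.update_self]
  congr 1
  refine Finset.prod_congr rfl fun j hj => ?_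
  rw [Function.update_of_ne (Finset.ne_of_mem_erase hj)]

theorem multiProd_add (A B : Tensor n) (M : (i : Fin d) → Matrix (Fin (m i)) (Fin (n i)) ℝ) :
    multiProd (A + B) M = multiProd A M + multiProd B M := by
  ext k
  simp [multiProd_apply, mul_add, Finset.sum_add_distrib]

theorem multiProd_smul (c : ℝ) (A : Tensor n)
    (M : (i : Fin d) → Matrix (Fin (m i)) (Fin (n i)) ℝ) :
    multiProd (c • A) M = c • multiProd A M := by
  ext k
  simp only [multiProd_apply, PiLp.smul_apply, smul_eq_mul, Finset.mul_sum]
  exact Finset.sum_congr rfl fun _ _ => by ring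

/-- The simultaneous mode products as a linear map of the tensor. -/
def multiProdL (M : (i : Fin d) → Matrix (Fin (m i)) (Fin (n i)) ℝ) : Tensor n →ₗ[ℝ] Tensor m where
  toFun A := multiProd A M
  map_add' A B := multiProd_add A B M
  map_smul' c A := multiProd_smul c A M

theorem multiProd_zero (M : (i : Fin d) → Matrix (Fin (m i)) (Fin (n i)) ℝ) :
    multiProd (0 : Tensor n) M = 0 := (multiProdL M).map_zero

theorem multiProd_sub (A B : Tensor n) (M : (i : Fin d) → Matrix (Fin (m i)) (Fin (n i)) ℝ) :
    multiProd (A - B) M = multiProd A M - multiProd B M := (multiProdL M).map_sub A B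

theorem multiProd_sum {ι : Type*} (s : Finset ι) (A : ι → Tensor n)
    (M : (i : Fin d) → Matrix (Fin (m i)) (Fin (n i)) ℝ) :
    multiProd (∑ x ∈ s, A x) M = ∑ x ∈ s, multiProd (A x) M := map_sum (multiProdL M) A s

theorem multiProd_update_add (A : Tensor n) (M : (i : Fin d) → Matrix (Fin (m i)) (Fin (n i)) ℝ)
    (i : Fin d) (N N' : Matrix (Fin (m i)) (Fin (n i)) ℝ) :
    multiProd A (Function.update M i (N + N'))
      = multiProd A (Function.update M i N) + multiProd A (Function.update M i N') := by
  ext k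
  simp [multiProd_apply, prod_update_entry, add_mul, Finset.sum_add_distrib]

theorem multiProd_update_smul (A : Tensor n) (M : (i : Fin d) → Matrix (Fin (m i)) (Fin (n i)) ℝ)
    (i : Fin d) (c : ℝ) (N : Matrix (Fin (m i)) (Fin (n i)) ℝ) :
    multiProd A (Function.update M i (c • N)) = c • multiProd A (Function.update M i N) := by
  ext k
  simp only [multiProd_apply, prod_update_entry, PiLp.smul_apply, smul_eq_mul, Finset.mul_sum,
    Matrix.smul_apply]
  exact Finset.sum_congr rfl fun _ _ => by ring

theorem multiProd_eq_zero (A : Tensor n) {M : (i : Fin d) → Matrix (Fin (m i)) (Fin (n i)) ℝ}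
    {i : Fin d} (h : M i = 0) : multiProd A M = 0 := by
  have := multiProd_update_smul A M i 0 0
  rwa [zero_smul, zero_smul, ← h, Function.update_eq_self] at this

theorem multiProd_multiProd (A : Tensor n) (M : (i : Fin d) → Matrix (Fin (m i)) (Fin (n i)) ℝ)
    (N : (i : Fin d) → Matrix (Fin (p i)) (Fin (m i)) ℝ) :
    multiProd (multiProd A M) N = multiProd A fun i => N i * M i := by
  ext k
  simp only [multiProd_apply, Matrix.mul_apply, Finset.mul_sum, Finset.prod_univ_sum,
    Fintype.piFinset_univ, Finset.sum_mul, Finset.prod_mul_distrib]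
  rw [Finset.sum_comm]
  exact Finset.sum_congr rfl fun _ _ => Finset.sum_congr rfl fun _ _ => by ring

theorem multiProd_one (A : Tensor n) :
    multiProd A (fun i => (1 : Matrix (Fin (n i)) (Fin (n i)) ℝ)) = A := by
  ext k
  rw [multiProd_apply, Finset.sum_eq_single k]
  · simp
  · intro l _ hl
    obtain ⟨i, hi⟩ := Function.ne_iff.mp hl
    refine mul_eq_zero_of_left (Finset.prod_eq_zero (Finset.mem_univ i) ?_) _
    exact Matrix.one_apply_ne hi.symm
  · simp

theorem inner_eq_sum (A B : Tensor n) : inner ℝ A B = ∑ k, A k * B k := by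
  rw [PiLp.inner_apply]
  exact Finset.sum_congr rfl fun k _ => by simp [mul_comm]

theorem inner_multiProd (A : Tensor n) (M : (i : Fin d) → Matrix (Fin (m i)) (Fin (n i)) ℝ)
    (B : Tensor m) :
    inner ℝ (multiProd A M) B = inner ℝ A (multiProd B fun i => (M i)ᵀ) := by
  simp only [inner_eq_sum, multiProd_apply, Finset.mul_sum, Finset.sum_mul, Matrix.transpose_apply]
  rw [Finset.sum_comm]
  exact Finset.sum_congr rfl fun _ _ => Finset.sum_congr rfl fun _ _ => by ring

theorem matricize_add (i : Fin d) (A B : Tensor n) :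
    matricize i (A + B) = matricize i A + matricize i B := rfl

theorem matricize_smul (i : Fin d) (c : ℝ) (A : Tensor n) :
    matricize i (c • A) = c • matricize i A := rfl

/-- The mode-`i` matricization as a linear map. -/
def matricizeL (i : Fin d) : Tensor n →ₗ[ℝ] Matrix (Fin (n i)) (OtherIdx n i) ℝ where
  toFun := matricize i
  map_add' := matricize_add i
  map_smul' := matricize_smul i

theorem matricize_sub (i : Fin d) (A B : Tensor n) :
    matricize i (A - B) = matricize i A - matricize i B := rfl

theorem matricize_sum {ι : Type*} (i : Fin d) (s : Finset ι) (A : ι → Tensor n) :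
    matricize i (∑ x ∈ s, A x) = ∑ x ∈ s, matricize i (A x) := map_sum (matricizeL i) A s

theorem matricize_injective (i : Fin d) : Function.Injective (matricize i : Tensor n → _) := by
  intro A B h
  ext k
  have := congrFun (congrFun h ((Equiv.piSplitAt i fun j => Fin (n j)) k).1)
    ((Equiv.piSplitAt i fun j => Fin (n j)) k).2
  simpa only [matricize, Matrix.of_apply, Prod.mk.eta, Equiv.symm_apply_apply] using this

/-- Matricizing only reindexes the entries. The mode `i` is free, so each mode's term can be treated
as a matrix trace in its own unfolding. -/
theorem inner_eq_trace (i : Fin d) (A B : Tensor n) :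
    inner ℝ A B = ((matricize i A)ᵀ * matricize i B).trace := by
  rw [inner_eq_sum, ← (Equiv.piSplitAt i fun j => Fin (n j)).symm.sum_comp, Fintype.sum_prod_type,
    Finset.sum_comm]
  rfl

theorem kronOthers_congr (i : Fin d) {M N : (j : Fin d) → Matrix (Fin (m j)) (Fin (n j)) ℝ}
    (h : ∀ j, j ≠ i → M j = N j) : kronOthers i M = kronOthers i N := by
  ext c b
  simp only [kronOthers, Matrix.of_apply]
  exact Finset.prod_congr rfl fun j _ => by rw [h j.1 j.2]

theorem kronOthers_eq_zero {i k : Fin d} {M : (j : Fin d) → Matrix (Fin (m j)) (Fin (n j)) ℝ}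
    (hk : k ≠ i) (h : M k = 0) : kronOthers i M = 0 := by
  ext c b
  exact Finset.prod_eq_zero (Finset.mem_univ (⟨k, hk⟩ : {j // j ≠ i})) (by simp [h])

theorem kronOthers_one (i : Fin d) :
    kronOthers i (fun j => (1 : Matrix (Fin (n j)) (Fin (n j)) ℝ)) = 1 := by
  ext c b
  rw [kronOthers, Matrix.of_apply]
  by_cases h : c = b
  · subst h; simp
  · obtain ⟨j, hj⟩ := Function.ne_iff.mp h
    rw [Matrix.one_apply_ne h]
    exact Finset.prod_eq_zero (Finset.mem_univ j) (Matrix.one_apply_ne hj)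

theorem kronOthers_transpose (i : Fin d) (M : (j : Fin d) → Matrix (Fin (m j)) (Fin (n j)) ℝ) :
    (kronOthers i fun j => (M j)ᵀ) = (kronOthers i M)ᵀ := rfl

theorem kronOthers_mul (i : Fin d) (N : (j : Fin d) → Matrix (Fin (p j)) (Fin (m j)) ℝ)
    (M : (j : Fin d) → Matrix (Fin (m j)) (Fin (n j)) ℝ) :
    kronOthers i N * kronOthers i M = kronOthers i fun j => N j * M j := by
  ext c b
  simp only [kronOthers, Matrix.mul_apply, Matrix.of_apply, Finset.prod_univ_sum,
    Fintype.piFinset_univ, Finset.prod_mul_distrib]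

theorem matricizeOthers_add (i : Fin d) (A B : Tensor n)
    (M : (j : Fin d) → Matrix (Fin (m j)) (Fin (n j)) ℝ) :
    matricizeOthers i (A + B) M = matricizeOthers i A M + matricizeOthers i B M := by
  simp only [matricizeOthers, matricize_add, Matrix.add_mul]

theorem matricizeOthers_sub (i : Fin d) (A B : Tensor n)
    (M : (j : Fin d) → Matrix (Fin (m j)) (Fin (n j)) ℝ) :
    matricizeOthers i (A - B) M = matricizeOthers i A M - matricizeOthers i B M := by
  simp only [matricizeOthers, matricize_sub, Matrix.sub_mul]

theorem matricizeOthers_smul (i : Fin d) (c : ℝ) (A : Tensor n)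
    (M : (j : Fin d) → Matrix (Fin (m j)) (Fin (n j)) ℝ) :
    matricizeOthers i (c • A) M = c • matricizeOthers i A M := by
  simp only [matricizeOthers, matricize_smul, Matrix.smul_mul]

theorem matricizeOthers_sum {ι : Type*} (i : Fin d) (s : Finset ι) (A : ι → Tensor n)
    (M : (j : Fin d) → Matrix (Fin (m j)) (Fin (n j)) ℝ) :
    matricizeOthers i (∑ x ∈ s, A x) M = ∑ x ∈ s, matricizeOthers i (A x) M := by
  simp only [matricizeOthers, matricize_sum, Matrix.sum_mul]

theorem matricizeOthers_congr (i : Fin d) (A : Tensor n)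
    {M N : (j : Fin d) → Matrix (Fin (m j)) (Fin (n j)) ℝ} (h : ∀ j, j ≠ i → M j = N j) :
    matricizeOthers i A M = matricizeOthers i A N := by
  rw [matricizeOthers, kronOthers_congr i h, matricizeOthers]

theorem matricizeOthers_update_self (i : Fin d) (A : Tensor n)
    (M : (j : Fin d) → Matrix (Fin (m j)) (Fin (n j)) ℝ) (N : Matrix (Fin (m i)) (Fin (n i)) ℝ) :
    matricizeOthers i A (Function.update M i N) = matricizeOthers i A M :=
  matricizeOthers_congr i A fun _ hj => Function.update_of_ne hj _ _

theorem matricizeOthers_multiProd (i : Fin d) (A : Tensor n)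
    (M : (j : Fin d) → Matrix (Fin (m j)) (Fin (n j)) ℝ)
    (N : (j : Fin d) → Matrix (Fin (p j)) (Fin (m j)) ℝ) :
    matricizeOthers i (multiProd A M) N = M i * matricizeOthers i A fun j => N j * M j := by
  rw [matricizeOthers, matricize_multiProd, matricizeOthers, matricizeOthers, Matrix.mul_assoc,
    Matrix.mul_assoc, ← Matrix.transpose_mul, kronOthers_mul]

theorem matricizeOthers_eq_matricize (i : Fin d) (A : Tensor n)
    {M : (j : Fin d) → Matrix (Fin (n j)) (Fin (n j)) ℝ} (h : ∀ j, j ≠ i → M j = 1) :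
    matricizeOthers i A M = matricize i A := by
  rw [matricizeOthers, kronOthers_congr i (N := fun _ => 1) h, kronOthers_one,
    Matrix.transpose_one, Matrix.mul_one]

theorem matricizeOthers_eq_zero {i k : Fin d} (A : Tensor n)
    {M : (j : Fin d) → Matrix (Fin (m j)) (Fin (n j)) ℝ} (hk : k ≠ i) (h : M k = 0) :
    matricizeOthers i A M = 0 := by
  rw [matricizeOthers, kronOthers_eq_zero hk h, Matrix.transpose_zero, Matrix.mul_zero]

/-- The adjoint of a multilinear product, expressed by the mode-`i` matricizations. -/
theorem inner_multiProd_eq_trace (i : Fin d) (Z : Tensor m) (A : Tensor n)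
    (M : (j : Fin d) → Matrix (Fin (m j)) (Fin (n j)) ℝ) :
    inner ℝ Z (multiProd A M)
      = ((matricizeOthers i Z fun j => (M j)ᵀ)ᵀ * (M i * matricize i A)).trace := by
  rw [inner_eq_trace i, matricize_multiProd, matricizeOthers, matricizeOthers,
    kronOthers_transpose, Matrix.transpose_transpose, Matrix.transpose_mul, ← Matrix.mul_assoc,
    ← Matrix.mul_assoc, Matrix.trace_mul_comm, Matrix.mul_assoc, Matrix.mul_assoc]

theorem matricize_modeProd (A : Tensor n) (i : Fin d) (N : Matrix (Fin (n i)) (Fin (n i)) ℝ) :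
    matricize i (modeProd A i N) = N * matricize i A := by
  rw [modeProd, matricize_multiProd, Function.update_self, matricizeOthers_update_self,
    matricizeOthers_eq_matricize i A fun _ _ => rfl]

variable {r : Fin d → ℕ}

/-- `variation` as a linear map of the variations of the core and of the basis matrices. -/
def variationL (C : Tensor r) (U : (i : Fin d) → Matrix (Fin (n i)) (Fin (r i)) ℝ) :
    (Tensor r × ((i : Fin d) → Matrix (Fin (n i)) (Fin (r i)) ℝ)) →ₗ[ℝ] Tensor n where
  toFun v := variation C U v.1 v.2
  map_add' v w := by
    simp only [variation, Prod.fst_add, Prod.snd_add, Pi.add_apply, multiProd_add,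
      multiProd_update_add, Finset.sum_add_distrib]
    abel
  map_smul' c v := by
    simp only [variation, Prod.smul_fst, Prod.smul_snd, Pi.smul_apply, multiProd_smul,
      multiProd_update_smul, ← Finset.smul_sum, smul_add, RingHom.id_apply]

theorem variationL_apply (C : Tensor r) (U : (i : Fin d) → Matrix (Fin (n i)) (Fin (r i)) ℝ)
    (v : Tensor r × ((i : Fin d) → Matrix (Fin (n i)) (Fin (r i)) ℝ)) :
    variationL C U v = variation C U v.1 v.2 := rfl

/-- The coordinates `(E ×₁ U₁ᵀ ⋯, (I - U_i U_iᵀ) [E ×_{j ≠ i} U_jᵀ]_(i) C_(i)⁺)`, with respect to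
the parametrization by `variation C U`, of the projection of `E` onto the tangent space. -/
def tangentCoord (C : Tensor r) (U : (i : Fin d) → Matrix (Fin (n i)) (Fin (r i)) ℝ) :
    Tensor n →ₗ[ℝ] (Tensor r × ((i : Fin d) → Matrix (Fin (n i)) (Fin (r i)) ℝ)) where
  toFun E := (multiProd E fun i => (U i)ᵀ, fun i =>
    (1 - U i * (U i)ᵀ) * matricizeOthers i E (fun j => (U j)ᵀ) * pinv (matricize i C))
  map_add' A B := by
    ext1
    · exact multiProd_add _ _ _
    · funext i
      simp only [matricizeOthers_add, Matrix.mul_add, Matrix.add_mul, Prod.snd_add, Pi.add_apply]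
  map_smul' c A := by
    ext1
    · exact multiProd_smul _ _ _
    · funext i
      simp only [matricizeOthers_smul, Matrix.mul_smul, Matrix.smul_mul, Prod.smul_snd,
        Pi.smul_apply, RingHom.id_apply]

theorem tangentCoord_fst (C : Tensor r) (U : (i : Fin d) → Matrix (Fin (n i)) (Fin (r i)) ℝ)
    (E : Tensor n) : (tangentCoord C U E).1 = multiProd E fun i => (U i)ᵀ := rfl

theorem tangentCoord_snd (C : Tensor r) (U : (i : Fin d) → Matrix (Fin (n i)) (Fin (r i)) ℝ)
    (E : Tensor n) (i : Fin d) : (tangentCoord C U E).2 i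
      = (1 - U i * (U i)ᵀ) * matricizeOthers i E (fun j => (U j)ᵀ) * pinv (matricize i C) := rfl

/-- A change of the basis matrices within their column spaces is a change of the core. -/
theorem multiProd_update_mul (C : Tensor r) (W : (i : Fin d) → Matrix (Fin (n i)) (Fin (r i)) ℝ)
    (i : Fin d) (G : Matrix (Fin (r i)) (Fin (r i)) ℝ) :
    multiProd C (Function.update W i (W i * G)) = multiProd (modeProd C i G) W := by
  rw [modeProd, multiProd_multiProd]
  congr 1
  funext j
  by_cases h : j = i
  · subst h; simp
  · simp [Function.update_of_ne h]

/-- Gauge freedom of the parametrization of tangent vectors. -/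
theorem variation_gauge (C : Tensor r) (W : (i : Fin d) → Matrix (Fin (n i)) (Fin (r i)) ℝ)
    (D : Tensor r) (V : (i : Fin d) → Matrix (Fin (n i)) (Fin (r i)) ℝ)
    (G : (i : Fin d) → Matrix (Fin (r i)) (Fin (r i)) ℝ) :
    variation C W (D + ∑ i, modeProd C i (G i)) (fun i => V i - W i * G i)
      = variation C W D V := by
  have h : ∀ i, multiProd C (Function.update W i (V i))
      = multiProd C (Function.update W i (V i - W i * G i)) + multiProd (modeProd C i (G i)) W := by
    intro i
    rw [← multiProd_update_mul, ← multiProd_update_add, sub_add_cancel]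
  simp only [variation, h, Finset.sum_add_distrib, multiProd_add, multiProd_sum]
  abel

end Algebra

/-! ### Pseudoinverses of matrices of full row rank. -/

section Pinv

open Matrix

variable {α β : Type*} [Fintype α] [Fintype β] [DecidableEq α]

theorem isUnit_det_of_rank {A : Matrix α α ℝ} (h : A.rank = Fintype.card α) : IsUnit A.det := by
  rw [← Matrix.isUnit_iff_isUnit_det, ← Matrix.linearIndependent_rows_iff_isUnit,
    linearIndependent_iff_card_eq_finrank_span, ← h, Matrix.rank_eq_finrank_span_row]
  rfl

theorem isUnit_det_mul_transpose {A : Matrix α β ℝ} (h : A.rank = Fintype.card α) :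
    IsUnit (A * Aᵀ).det :=
  isUnit_det_of_rank (by rw [Matrix.rank_self_mul_transpose, h])

theorem mul_pinv {A : Matrix α β ℝ} (h : A.rank = Fintype.card α) : A * pinv A = 1 := by
  rw [pinv_of_isUnit_det (isUnit_det_mul_transpose h), ← Matrix.mul_assoc,
    Matrix.mul_nonsing_inv _ (isUnit_det_mul_transpose h)]

theorem transpose_pinv_mul {A : Matrix α β ℝ} (h : A.rank = Fintype.card α) :
    (pinv A * A)ᵀ = pinv A * A := by
  rw [pinv_of_isUnit_det (isUnit_det_mul_transpose h)]
  simp only [Matrix.transpose_mul, Matrix.transpose_transpose, Matrix.transpose_nonsing_inv,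
    Matrix.mul_assoc]

theorem mul_one_sub_pinv {A : Matrix α β ℝ} [DecidableEq β] (h : A.rank = Fintype.card α) :
    A * (1 - pinv A * A) = 0 := by
  rw [Matrix.mul_sub, Matrix.mul_one, ← Matrix.mul_assoc, mul_pinv h, Matrix.one_mul, sub_self]

end Pinv

/-! ### Explicit orthogonal projection onto the tangent space in orthonormal Tucker coordinates. -/

section Projection

open Matrix

variable {d : ℕ} {n r : Fin d → ℕ} {C : Tensor r}
  {U : (i : Fin d) → Matrix (Fin (n i)) (Fin (r i)) ℝ}

/-- Each basis summand acquires the zero factor `U_iᵀ V_i`, so only the core survives. -/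
theorem multiProd_variation_transpose (hU : ∀ i, (U i)ᵀ * U i = 1) (D : Tensor r)
    {V : (i : Fin d) → Matrix (Fin (n i)) (Fin (r i)) ℝ} (hV : ∀ i, (U i)ᵀ * V i = 0) :
    multiProd (variation C U D V) (fun i => (U i)ᵀ) = D := by
  rw [variation, multiProd_add, multiProd_sum, Finset.sum_eq_zero, add_zero, multiProd_multiProd]
  · simp only [hU, multiProd_one]
  · intro i _
    rw [multiProd_multiProd]
    exact multiProd_eq_zero (i := i) _ (by rw [Function.update_self, hV])

theorem matricizeOthers_variation {p : Fin d → ℕ} (i : Fin d) (D : Tensor r)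
    (V : (i : Fin d) → Matrix (Fin (n i)) (Fin (r i)) ℝ)
    (N : (i : Fin d) → Matrix (Fin (p i)) (Fin (n i)) ℝ) (hV : ∀ k, k ≠ i → N k * V k = 0) :
    matricizeOthers i (variation C U D V) N
      = U i * matricizeOthers i D (fun j => N j * U j)
        + V i * matricizeOthers i C (fun j => N j * U j) := by
  rw [variation, matricizeOthers_add, matricizeOthers_sum, matricizeOthers_multiProd,
    Finset.sum_eq_single i]
  · rw [matricizeOthers_multiProd, Function.update_self]
    congr 2
    exact matricizeOthers_congr i C fun j hj => by rw [Function.update_of_ne hj]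
  · intro k _ hk
    rw [matricizeOthers_multiProd,
      matricizeOthers_eq_zero C hk (by rw [Function.update_self, hV k hk]), Matrix.mul_zero]
  · simp

theorem matricizeOthers_variation_transpose (hU : ∀ i, (U i)ᵀ * U i = 1) (i : Fin d) (D : Tensor r)
    {V : (i : Fin d) → Matrix (Fin (n i)) (Fin (r i)) ℝ} (hV : ∀ i, (U i)ᵀ * V i = 0) :
    matricizeOthers i (variation C U D V) (fun j => (U j)ᵀ)
      = U i * matricize i D + V i * matricize i C := by
  rw [matricizeOthers_variation i D V _ fun k _ => hV k,
    matricizeOthers_eq_matricize i D fun j _ => hU j,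
    matricizeOthers_eq_matricize i C fun j _ => hU j]

theorem transpose_mul_one_sub {α β : Type*} [Fintype α] [DecidableEq α] [Fintype β]
    [DecidableEq β] {U : Matrix α β ℝ} (hU : Uᵀ * U = 1) : Uᵀ * (1 - U * Uᵀ) = 0 := by
  rw [Matrix.mul_sub, Matrix.mul_one, ← Matrix.mul_assoc, hU, Matrix.one_mul, sub_self]

theorem one_sub_mul_of_transpose_mul {α β γ : Type*} [Fintype α] [DecidableEq α] [Fintype β]
    {U : Matrix α β ℝ} {V : Matrix α γ ℝ} (hV : Uᵀ * V = 0) : (1 - U * Uᵀ) * V = V := by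
  rw [Matrix.sub_mul, Matrix.one_mul, Matrix.mul_assoc, hV, Matrix.mul_zero, sub_zero]

theorem transpose_mul_tangentCoord (hU : ∀ i, (U i)ᵀ * U i = 1) (E : Tensor n) (i : Fin d) :
    (U i)ᵀ * (tangentCoord C U E).2 i = 0 := by
  rw [tangentCoord_snd, ← Matrix.mul_assoc, ← Matrix.mul_assoc, transpose_mul_one_sub (hU i),
    Matrix.zero_mul, Matrix.zero_mul]

/-- The gauge condition `U_iᵀ V_i = 0` makes tangent coordinates unique: the factor `1 - U_i U_iᵀ`
removes the core contribution, and `C_(i) C_(i)⁺ = 1` recovers `V_i`. -/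
theorem tangentCoord_variation (hU : ∀ i, (U i)ᵀ * U i = 1)
    (hC : ∀ i, (matricize i C).rank = r i) (D : Tensor r)
    {V : (i : Fin d) → Matrix (Fin (n i)) (Fin (r i)) ℝ} (hV : ∀ i, (U i)ᵀ * V i = 0) :
    tangentCoord C U (variation C U D V) = (D, V) := by
  ext1
  · exact multiProd_variation_transpose hU D hV
  · funext i
    have hCi : matricize i C * pinv (matricize i C) = 1 := mul_pinv (by simp [hC i])
    rw [tangentCoord_snd, matricizeOthers_variation_transpose hU i D hV, Matrix.mul_add,
      ← Matrix.mul_assoc, ← Matrix.mul_assoc, one_sub_mul_of_transpose_mul (hV i),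
      Matrix.sub_mul, Matrix.one_mul, Matrix.mul_assoc (U i), hU i, Matrix.mul_one, sub_self,
      Matrix.zero_mul, zero_add, Matrix.mul_assoc, hCi, Matrix.mul_one]

/-- The orthogonal complement of the tangent space, in terms of matricizations. -/
theorem matricizeOthers_sub_projection (hU : ∀ i, (U i)ᵀ * U i = 1) (E : Tensor n) (i : Fin d) :
    matricizeOthers i (E - variationL C U (tangentCoord C U E)) (fun j => (U j)ᵀ)
      = (1 - U i * (U i)ᵀ) * matricizeOthers i E (fun j => (U j)ᵀ)
        * (1 - pinv (matricize i C) * matricize i C) := by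
  rw [variationL_apply, matricizeOthers_sub, matricizeOthers_variation_transpose hU i _
    (transpose_mul_tangentCoord hU E), tangentCoord_snd, tangentCoord_fst, matricize_multiProd]
  simp only [Matrix.mul_sub, Matrix.sub_mul, Matrix.mul_one, Matrix.one_mul, Matrix.mul_assoc]
  abel

theorem multiProd_sub_projection (hU : ∀ i, (U i)ᵀ * U i = 1) (E : Tensor n) :
    multiProd (E - variationL C U (tangentCoord C U E)) (fun i => (U i)ᵀ) = 0 := by
  rw [variationL_apply, multiProd_sub, multiProd_variation_transpose hU _
    (transpose_mul_tangentCoord hU E), tangentCoord_fst, sub_self]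

theorem inner_multiProd_update (i : Fin d) (Z : Tensor n) (A : Tensor r)
    (V : Matrix (Fin (n i)) (Fin (r i)) ℝ) :
    inner ℝ Z (multiProd A (Function.update U i V))
      = ((matricizeOthers i Z fun j => (U j)ᵀ)ᵀ * (V * matricize i A)).trace := by
  rw [inner_multiProd_eq_trace i, Function.update_self]
  congr 3
  exact matricizeOthers_congr i Z fun j hj => by rw [Function.update_of_ne hj]

theorem inner_multiProd_right (Z : Tensor n) (A : Tensor r) :
    inner ℝ Z (multiProd A U) = inner ℝ (multiProd Z fun i => (U i)ᵀ) A := by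
  rw [real_inner_comm, inner_multiProd, real_inner_comm]

/-- The residual has zero core, and its mode-`i` unfolding ends in `1 - C_(i)⁺ C_(i)`, which `C_(i)`
annihilates. No gauge condition on `V` is needed. -/
theorem inner_sub_projection_variation (hU : ∀ i, (U i)ᵀ * U i = 1)
    (hC : ∀ i, (matricize i C).rank = r i) (E : Tensor n) (D : Tensor r)
    (V : (i : Fin d) → Matrix (Fin (n i)) (Fin (r i)) ℝ) :
    inner ℝ (E - variationL C U (tangentCoord C U E)) (variation C U D V) = 0 := by
  rw [variation, inner_add_right, inner_multiProd_right, multiProd_sub_projection hU,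
    inner_zero_left, zero_add, inner_sum]
  refine Finset.sum_eq_zero fun i _ => ?_
  have hCi : matricize i C * (1 - pinv (matricize i C) * matricize i C)  = 0 :=
    mul_one_sub_pinv (by simp [hC i])
  rw [inner_multiProd_update, matricizeOthers_sub_projection hU, ← Matrix.mul_assoc,
    Matrix.trace_mul_comm, ← Matrix.mul_assoc, Matrix.transpose_mul, ← Matrix.mul_assoc,
    Matrix.transpose_sub, transpose_pinv_mul (by simp [hC i]), Matrix.transpose_one, hCi]
  simp

theorem inner_variation_variation (hU : ∀ i, (U i)ᵀ * U i = 1) (D' D : Tensor r)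
    {V' V : (i : Fin d) → Matrix (Fin (n i)) (Fin (r i)) ℝ}
    (hV' : ∀ i, (U i)ᵀ * V' i = 0) (hV : ∀ i, (U i)ᵀ * V i = 0) :
    inner ℝ (variation C U D' V') (variation C U D V)
      = inner ℝ D' D
        + ∑ i, ((V' i * matricize i C)ᵀ * (V i * matricize i C)).trace := by
  conv_lhs => rw [variation.eq_def C U D V]
  rw [inner_add_right, inner_multiProd_right, multiProd_variation_transpose hU _ hV', inner_sum]
  congr 1
  refine Finset.sum_congr rfl fun i _ => ?_
  rw [inner_multiProd_update, matricizeOthers_variation_transpose hU i _ hV', Matrix.transpose_add,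
    Matrix.add_mul, Matrix.trace_add, Matrix.transpose_mul (U i), Matrix.mul_assoc _ (U i)ᵀ,
    ← Matrix.mul_assoc (U i)ᵀ, hV i, Matrix.zero_mul, Matrix.mul_zero, Matrix.trace_zero, zero_add]

end Projection

/-! ### The second fundamental form, evaluated by traces. -/

section Curvature

open Matrix

variable {d : ℕ} {n r : Fin d → ℕ} {C : Tensor r}
  {U : (i : Fin d) → Matrix (Fin (n i)) (Fin (r i)) ℝ}

theorem transpose_mul_curvatureBasis (hU : ∀ i, (U i)ᵀ * U i = 1) (C' : Tensor r)
    (U' : (i : Fin d) → Matrix (Fin (n i)) (Fin (r i)) ℝ) (E : Tensor n) (i : Fin d) :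
    (U i)ᵀ * curvatureBasis C U C' U' E i = 0 := by
  rw [curvatureBasis, ← Matrix.mul_assoc, ← Matrix.mul_assoc, transpose_mul_one_sub (hU i),
    Matrix.zero_mul, Matrix.zero_mul]

theorem one_sub_transpose {α β : Type*} [Fintype β] [DecidableEq α] (U : Matrix α β ℝ) :
    (1 - U * Uᵀ)ᵀ = 1 - U * Uᵀ := by
  simp [Matrix.transpose_sub, Matrix.transpose_mul]

/-- Mode by mode, the normal part contributes the factor `1 - C_(i)⁺ C_(i)`. Its two terms are the
two terms of `curvatureCore`, and the factor `1 - U_i U_iᵀ` is absorbed by `U'_iᵀ`. -/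
theorem inner_curvatureCore (hU : ∀ i, (U i)ᵀ * U i = 1)
    {U' : (i : Fin d) → Matrix (Fin (n i)) (Fin (r i)) ℝ} (hU' : ∀ i, (U' i)ᵀ * U i = 0)
    (E : Tensor n) (D : Tensor r) :
    inner ℝ (E - variationL C U (tangentCoord C U E))
        (∑ i, multiProd D (Function.update U i (U' i)))
      = inner ℝ (curvatureCore C U U' E) D := by
  rw [inner_sum, curvatureCore, sum_inner]
  refine Finset.sum_congr rfl fun i _ => ?_
  rw [inner_multiProd_update, matricizeOthers_sub_projection hU, inner_eq_trace i, matricize_sub,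
    matricize_modeProd, matricize_multiProd, Function.update_self, matricizeOthers_update_self,
    ← Matrix.mul_assoc, ← Matrix.transpose_transpose (U' i), ← Matrix.transpose_mul]
  congr 3
  have hP : (U' i)ᵀ * (1 - U i * (U i)ᵀ) = (U' i)ᵀ := by
    rw [Matrix.mul_sub, Matrix.mul_one, ← Matrix.mul_assoc, hU' i, Matrix.zero_mul, sub_zero]
  rw [Matrix.transpose_transpose, ← Matrix.mul_assoc, ← Matrix.mul_assoc, hP, Matrix.mul_sub,
    Matrix.mul_one]
  simp only [Matrix.mul_assoc]

/-- Each summand of a tangent vector replaces at most one of the `U_j`, so it keeps `U_i` or `U_k`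
in one of the two modes where the other tensor is orthogonal to it. -/
theorem inner_projection_of_two_modes
    {U' V : (i : Fin d) → Matrix (Fin (n i)) (Fin (r i)) ℝ} (hU' : ∀ i, (U' i)ᵀ * U i = 0)
    (hV : ∀ i, (U i)ᵀ * V i = 0) (E : Tensor n) (A : Tensor r) {i k : Fin d} (hk : k ≠ i) :
    inner ℝ (variationL C U (tangentCoord C U E))
      (multiProd A (Function.update (Function.update U i (V i)) k (U' k))) = 0 := by
  have hk' : Function.update (Function.update U i (V i)) k (U' k) k = U' k :=
    Function.update_self _ _ _
  have hi' : Function.update (Function.update U i (V i)) k (U' k) i = V i := by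
    rw [Function.update_of_ne hk.symm, Function.update_self]
  have hVi : (V i)ᵀ * U i = 0 := by
    rw [← Matrix.transpose_transpose (U i), ← Matrix.transpose_mul, hV i, Matrix.transpose_zero]
  rw [real_inner_comm, inner_multiProd, variationL_apply, variation, multiProd_add,
    multiProd_sum, multiProd_multiProd, multiProd_eq_zero (i := i) _ (by rw [hi', hVi]),
    Finset.sum_eq_zero, add_zero, inner_zero_right]
  intro j _
  rw [multiProd_multiProd]
  by_cases hj : j = i
  · exact multiProd_eq_zero (i := k) _
      (by rw [hk', Function.update_of_ne (by rw [hj]; exact hk), hU'])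
  · exact multiProd_eq_zero (i := i) _ (by rw [hi', Function.update_of_ne (Ne.symm hj), hVi])

/-- The core variation `C'` produces the first term of `curvatureBasis`, and the modes `k ≠ i`
produce its sum. The mode `i` itself drops out, because `U'` is replaced by `0` there. -/
theorem inner_curvatureBasis (hU : ∀ i, (U i)ᵀ * U i = 1) (hC : ∀ i, (matricize i C).rank = r i)
    (C' : Tensor r) {U' V : (i : Fin d) → Matrix (Fin (n i)) (Fin (r i)) ℝ}
    (hU' : ∀ i, (U' i)ᵀ * U i = 0) (hV : ∀ i, (U i)ᵀ * V i = 0) (E : Tensor n) (i : Fin d) :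
    inner ℝ (E - variationL C U (tangentCoord C U E))
        (variation C (Function.update U i (V i)) C' (Function.update U' i 0))
      = ((curvatureBasis C U C' U' E i * matricize i C)ᵀ * (V i * matricize i C)).trace := by
  have hr : (matricize i C).rank = Fintype.card (Fin (r i)) := by simp [hC i]
  have hCP := mul_pinv hr
  have hPV : (1 - U i * (U i)ᵀ) * V i = V i := one_sub_mul_of_transpose_mul (hV i)
  -- With two modes varied, the tangential part of `E` is orthogonal, so `E` itself may replace its
  -- normal part.
  have h2 : ∀ k ∈ Finset.univ.erase i,
      inner ℝ (E - variationL C U (tangentCoord C U E)) (multiProd C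
        (Function.update (Function.update U i (V i)) k (Function.update U' i 0 k)))
      = ((matricizeOthers i E (Function.update (fun j => (U j)ᵀ) k (U' k)ᵀ))ᵀ
          * (V i * matricize i C)).trace := by
    intro k hk
    have hk := Finset.ne_of_mem_erase hk
    rw [Function.update_of_ne hk, inner_sub_left, inner_projection_of_two_modes hU' hV E C hk,
      sub_zero, inner_multiProd_eq_trace i]
    rw [Function.update_of_ne hk.symm, Function.update_self]
    congr 3
    refine matricizeOthers_congr i E fun j hj => ?_
    by_cases hjk : j = k
    · subst hjk; simp
    · simp [Function.update_of_ne hjk, Function.update_of_ne hj]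
  rw [variation, inner_add_right, inner_sum, inner_multiProd_update,
    ← Finset.add_sum_erase _ _ (Finset.mem_univ i), Finset.sum_congr rfl h2,
    multiProd_eq_zero (i := i) C (by simp), inner_zero_right, zero_add,
    matricizeOthers_sub_projection hU, ← Matrix.trace_sum, ← Matrix.sum_mul,
    ← Matrix.transpose_sum, curvatureBasis]
  set S := ∑ k ∈ Finset.univ.erase i,
    matricizeOthers i E (Function.update (fun j => (U j)ᵀ) k (U' k)ᵀ)
  set Q := 1 - pinv (matricize i C) * matricize i C
  set M := matricizeOthers i E fun j => (U j)ᵀ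
  -- The outer factors `1 - U_i U_iᵀ` and `C_(i)⁺ C_(i)` are self-adjoint and fix `V_i C_(i)` from
  -- the left and from the right.
  have key : ∀ A : Matrix (Fin (n i)) (OtherIdx r i) ℝ,
      (((1 - U i * (U i)ᵀ) * A * pinv (matricize i C) * matricize i C)ᵀ
        * (V i * matricize i C)).trace = (Aᵀ * (V i * matricize i C)).trace := by
    intro A
    rw [Matrix.mul_assoc _ (pinv _), Matrix.transpose_mul, transpose_pinv_mul hr,
      Matrix.mul_assoc, Matrix.trace_mul_comm, Matrix.transpose_mul, one_sub_transpose,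
      Matrix.mul_assoc, Matrix.mul_assoc, ← Matrix.mul_assoc (1 - _), ← Matrix.mul_assoc (1 - _),
      hPV, Matrix.mul_assoc, ← Matrix.mul_assoc (matricize i C), hCP, Matrix.one_mul]
  rw [key, Matrix.transpose_add, Matrix.add_mul, Matrix.trace_add]
  congr 1
  rw [Matrix.transpose_mul (M * Q * _) _, Matrix.transpose_mul (M * Q) _,
    Matrix.transpose_transpose, Matrix.transpose_transpose, Matrix.mul_assoc (pinv _),
    Matrix.trace_mul_comm (pinv _), Matrix.mul_assoc (matricize i C' * _), Matrix.mul_assoc (V i),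
    hCP, Matrix.mul_one, Matrix.mul_assoc (matricize i C'),
    Matrix.trace_mul_comm (matricize i C'), Matrix.mul_assoc (1 - _),
    Matrix.transpose_mul (1 - _), Matrix.transpose_mul M Q,
    one_sub_transpose]
  simp only [Matrix.mul_assoc]
  rw [← Matrix.mul_assoc (1 - _) (V i), hPV]

/-- The curvature term is the Weingarten map: its inner product with a tangent vector is the inner
product of the normal component of `E` with the second derivative of the parametrization. -/
theorem inner_variation_curvature (hU : ∀ i, (U i)ᵀ * U i = 1)
    (hC : ∀ i, (matricize i C).rank = r i) (C' D : Tensor r)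
    {U' V : (i : Fin d) → Matrix (Fin (n i)) (Fin (r i)) ℝ}
    (hU' : ∀ i, (U' i)ᵀ * U i = 0) (hV : ∀ i, (U i)ᵀ * V i = 0) (E : Tensor n) :
    inner ℝ (variation C U (curvatureCore C U U' E) (curvatureBasis C U C' U' E))
        (variation C U D V)
      = inner ℝ (E - variationL C U (tangentCoord C U E))
        (variation D U 0 U'
          + ∑ i, variation C (Function.update U i (V i)) C' (Function.update U' i 0)) := by
  rw [inner_variation_variation hU _ _ (transpose_mul_curvatureBasis hU C' U' E) hV,
    inner_add_right, variation.eq_def D U, multiProd_zero, zero_add, inner_curvatureCore hU hU',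
    inner_sum]
  congr 1
  exact Finset.sum_congr rfl fun i _ => (inner_curvatureBasis hU hC C' hU' hV E i).symm

end Curvature

/-! ### Derivatives along a subset of a Euclidean space, tangent projections and gradients. -/

section TangentDerivative

variable {E F : Type*} [NormedAddCommGroup E] [InnerProductSpace ℝ E]
  [NormedAddCommGroup F] [NormedSpace ℝ F] {M : Set E} {x : E}

/-- Derivatives within `M` are unique on the tangent space. -/
theorem HasFDerivWithinAt.eq_on_tangentSpace {f : E → F} {f₁ f₂ : E →L[ℝ] F}
    (h₁ : HasFDerivWithinAt f f₁ M x) (h₂ : HasFDerivWithinAt f f₂ M x) {v : E}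
    (hv : v ∈ tangentSpace M x) : f₁ v = f₂ v := by
  have : tangentSpace M x ≤ LinearMap.eqLocus (f₁ : E →ₗ[ℝ] F) (f₂ : E →ₗ[ℝ] F) := by
    refine Submodule.span_le.mpr ?_
    rintro w ⟨γ, -, hM, h0, hγ⟩
    exact (h₁.comp_hasDerivAt_of_eq 0 hγ hM h0.symm).unique
      (h₂.comp_hasDerivAt_of_eq 0 hγ hM h0.symm)
  exact this hv

/-- `fderivWithin` may involve an arbitrary choice in normal directions; on tangent vectors the
chain rule along curves forces its value. -/
theorem fderivWithin_eq_on_tangentSpace {f : E → F} {f' : E →L[ℝ] F}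
    (h : HasFDerivWithinAt f f' M x) {v : E} (hv : v ∈ tangentSpace M x) :
    fderivWithin ℝ f M x v = f' v :=
  HasFDerivWithinAt.eq_on_tangentSpace h.differentiableWithinAt.hasFDerivWithinAt h hv

variable [FiniteDimensional ℝ E]

theorem tangentProj_mem (M : Set E) (x v : E) : tangentProj M x v ∈ tangentSpace M x :=
  Submodule.starProjection_apply_mem _ _

theorem tangentProj_of_mem {v : E} (hv : v ∈ tangentSpace M x) : tangentProj M x v = v :=
  Submodule.starProjection_eq_self_iff.mpr hv

theorem tangentProj_tangentProj (M : Set E) (x v : E) :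
    tangentProj M x (tangentProj M x v) = tangentProj M x v :=
  tangentProj_of_mem (tangentProj_mem M x v)

theorem inner_tangentProj (M : Set E) (x v w : E) :
    inner ℝ (tangentProj M x v) w = inner ℝ v (tangentProj M x w) :=
  Submodule.inner_starProjection_left_eq_right _ _ _

/-- The derivative of the tangent projection maps tangent vectors to normal vectors. -/
theorem tangentProj_fderivWithin_tangentProj
    (h : DifferentiableWithinAt ℝ (tangentProj M) M x) {ξ : E} (hξ : ξ ∈ tangentSpace M x) (v : E) :
    tangentProj M x (fderivWithin ℝ (tangentProj M) M x ξ (tangentProj M x v)) = 0 := by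
  set L := fderivWithin ℝ (tangentProj M) M x
  have h1 : HasFDerivWithinAt (tangentProj M) L M x := h.hasFDerivWithinAt
  have h2 := h1.clm_comp h1
  have h3 : (fun y => (tangentProj M y).comp (tangentProj M y)) = tangentProj M := by
    funext y
    ext w
    exact tangentProj_tangentProj M y w
  rw [h3] at h2
  -- Differentiating `P P = P` gives `L ξ = P (L ξ) + (L ξ) P`. Applying `P` on the left cancels `P
  -- (L ξ)` and leaves `P (L ξ) P = 0`.
  have h4 := congrArg (fun A : E →L[ℝ] E => tangentProj M x (A v))
    (HasFDerivWithinAt.eq_on_tangentSpace h1 h2 hξ)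
  simpa [tangentProj_tangentProj] using h4

/-- The Weingarten identity: for a curve in `M` with velocity `ξ` and a tangent vector field `η`
along it, `⟪P (D_ξ P) P^⊥ E, η(0)⟫ = ⟪P^⊥ E, η'(0)⟫`. -/
theorem inner_tangentProj_fderivWithin (h : DifferentiableWithinAt ℝ (tangentProj M) M x)
    {γ η : ℝ → E} {ξ η' : E} (hγ : HasDerivAt γ ξ 0) (hM : ∀ᶠ t in 𝓝 (0 : ℝ), γ t ∈ M)
    (h0 : γ 0 = x) (hη : HasDerivAt η η' 0)
    (hT : ∀ᶠ t in 𝓝 (0 : ℝ), η t ∈ tangentSpace M (γ t)) (v : E) :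
    inner ℝ (tangentProj M x (fderivWithin ℝ (tangentProj M) M x ξ (v - tangentProj M x v))) (η 0)
      = inner ℝ (v - tangentProj M x v) η' := by
  set L := fderivWithin ℝ (tangentProj M) M x
  set Z := v - tangentProj M x v
  have hP : HasDerivAt (fun t => tangentProj M (γ t)) (L ξ) 0 :=
    h.hasFDerivWithinAt.comp_hasDerivAt_of_eq 0 hγ hM h0.symm
  have hZ : tangentProj M x Z = 0 := by
    rw [map_sub, tangentProj_tangentProj, sub_self]
  have hη0 : tangentProj M x (η 0) = η 0 := tangentProj_of_mem (h0 ▸ hT.self_of_nhds)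
  have h1 : HasDerivAt (fun t => inner ℝ (tangentProj M (γ t) Z) (η t))
      (inner ℝ (tangentProj M (γ 0) Z) η' + inner ℝ (L ξ Z) (η 0)) 0 := by
    have := (hP.clm_apply (hasDerivAt_const (0 : ℝ) Z)).inner ℝ hη
    simpa using this
  have h2 : HasDerivAt (fun t => inner ℝ Z (η t)) (inner ℝ Z η') 0 := by
    simpa using (hasDerivAt_const (0 : ℝ) Z).inner ℝ hη
  have h3 : (fun t => inner ℝ (tangentProj M (γ t) Z) (η t)) =ᶠ[𝓝 0] fun t => inner ℝ Z (η t) := by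
    filter_upwards [hT] with t ht
    rw [inner_tangentProj, tangentProj_of_mem ht]
  have h4 := h1.unique (h2.congr_of_eventuallyEq h3)
  rw [h0, hZ, inner_zero_left, zero_add] at h4
  rw [inner_tangentProj, hη0, h4]

/-- The orthogonal projection onto the range of `S`, where `P` is idempotent with `P S† = S†`. -/
theorem starProjection_range_eq {P S R : E →L[ℝ] E} {K : Submodule ℝ E}
    (hK : LinearMap.range (S : E →ₗ[ℝ] E) = K) (hPS : P * S.adjoint = S.adjoint) (hPP : P * P = P)
    (hR : (S.adjoint * S + (1 - P)) * R = 1) :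
    K.starProjection = S * (R * S.adjoint) := by
  have h1 : S.adjoint * (S * (R * S.adjoint)) = S.adjoint := by
    -- Multiplying by `P` on the left kills the summand `1 - P`; what remains is the normal
    -- equation, by which the residual is orthogonal to the range of `S`.
    have h2 := congrArg (fun A => P * A * S.adjoint) hR
    simp only [mul_one, ← mul_assoc, mul_add, mul_sub, hPS, hPP, sub_self, add_zero] at h2
    simpa only [mul_assoc] using h2
  ext v
  refine (Submodule.eq_starProjection_of_mem_of_inner_eq_zero ?_ ?_)
  · rw [← hK]; exact ⟨_, rfl⟩
  · intro w hw
    rw [← hK] at hw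
    obtain ⟨u, rfl⟩ := hw
    have h2 : S.adjoint ((S * (R * S.adjoint)) v) = S.adjoint v :=
      congrArg (fun A : E →L[ℝ] E => A v) h1
    rw [ContinuousLinearMap.coe_coe, ← ContinuousLinearMap.adjoint_inner_left, map_sub, h2,
      sub_self, inner_zero_left]

theorem riemGrad_eq {f : E → ℝ} {g y : E}
    (h : HasFDerivAt f (innerSL ℝ g) y) : riemGrad M f y = tangentProj M y g := by
  refine (Submodule.eq_starProjection_of_mem_of_inner_eq_zero (K := tangentSpace M y)
    (Submodule.coe_mem _) fun w hw => ?_).symm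
  have := InnerProductSpace.toDual_symm_apply (𝕜 := ℝ) (x := (⟨w, hw⟩ : tangentSpace M y))
    (y := (fderivWithin ℝ f M y).comp (tangentSpace M y).subtypeL)
  rw [inner_sub_left, sub_eq_zero]
  refine Eq.trans ?_ this.symm
  exact (fderivWithin_eq_on_tangentSpace h.hasFDerivWithinAt hw).symm

end TangentDerivative

/-! ### Differentiation and smoothness of mode products, determinants and inverses. -/

section Smoothness

open Matrix

variable {d : ℕ} {n m r : Fin d → ℕ}

/-- The product rule for a multilinear expression, whose derivative is `variation` by design.
Entrywise hypotheses avoid choosing a norm on matrices. -/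
theorem hasDerivAt_multiProd {A : ℝ → Tensor n} {A' : Tensor n}
    {M : ℝ → (i : Fin d) → Matrix (Fin (m i)) (Fin (n i)) ℝ}
    {M' : (i : Fin d) → Matrix (Fin (m i)) (Fin (n i)) ℝ} {t : ℝ}
    (hA : HasDerivAt A A' t) (hM : ∀ i a b, HasDerivAt (fun s => M s i a b) (M' i a b) t) :
    HasDerivAt (fun s => multiProd (A s) (M s)) (variation (A t) (M t) A' M') t := by
  have hA' : ∀ l, HasDerivAt (fun s => A s l) (A' l) t := fun l => by
    have := (EuclideanSpace.proj l : Tensor n →L[ℝ] ℝ).hasFDerivAt.comp_hasDerivAt t hA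
    exact this
  have key : HasDerivAt (fun s => (WithLp.ofLp (multiProd (A s) (M s)) : _ → ℝ))
      (WithLp.ofLp (variation (A t) (M t) A' M')) t := by
    rw [hasDerivAt_pi]
    intro k
    have h1 : ∀ l, HasDerivAt (fun s => (∏ i, M s i (k i) (l i)) * A s l)
        ((∑ i, (∏ j ∈ Finset.univ.erase i, M t j (k j) (l j)) • M' i (k i) (l i)) * A t l
          + (∏ i, M t i (k i) (l i)) * A' l) t := fun l =>
      (HasDerivAt.fun_finsetProd fun i _ => hM i (k i) (l i)).mul (hA' l)
    have h2 := HasDerivAt.fun_sum (u := Finset.univ) fun l _ => h1 l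
    convert! h2 using 1
    simp only [variation, PiLp.add_apply, WithLp.ofLp_sum, Finset.sum_apply, multiProd_apply,
      prod_update_entry, Finset.sum_add_distrib, smul_eq_mul, Finset.sum_mul]
    rw [add_comm, Finset.sum_comm]
    congr 1
    exact Finset.sum_congr rfl fun _ _ => Finset.sum_congr rfl fun _ _ => by ring
  exact (PiLp.continuousLinearEquiv 2 ℝ _).symm.toContinuousLinearMap.hasFDerivAt.comp_hasDerivAt t
    key

variable {E : Type*} [NormedAddCommGroup E] [NormedSpace ℝ E] {s : Set E}

theorem contDiffOn_multiProd {A : E → Tensor n}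
    {M : E → (i : Fin d) → Matrix (Fin (m i)) (Fin (n i)) ℝ}
    (hA : ContDiffOn ℝ ∞ A s) (hM : ∀ i a b, ContDiffOn ℝ ∞ (fun x => M x i a b) s) :
    ContDiffOn ℝ ∞ (fun x => multiProd (A x) (M x)) s := by
  rw [contDiffOn_euclidean] at hA ⊢
  intro k
  exact ContDiffOn.sum fun l _ => (contDiffOn_prod fun i _ => hM i _ _).mul (hA l)

theorem contDiffOn_variation {A D : E → Tensor r}
    {M V : E → (i : Fin d) → Matrix (Fin (n i)) (Fin (r i)) ℝ}
    (hA : ContDiffOn ℝ ∞ A s) (hM : ∀ i a b, ContDiffOn ℝ ∞ (fun x => M x i a b) s)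
    (hD : ContDiffOn ℝ ∞ D s) (hV : ∀ i a b, ContDiffOn ℝ ∞ (fun x => V x i a b) s) :
    ContDiffOn ℝ ∞ (fun x => variation (A x) (M x) (D x) (V x)) s := by
  refine (contDiffOn_multiProd hD hM).add (ContDiffOn.sum fun i _ => contDiffOn_multiProd hA ?_)
  intro j a b
  by_cases h : j = i
  · subst h; simpa using hV j a b
  · simpa [Function.update_of_ne h] using hM j a b

theorem contDiffOn_matrix_mul {α β κ : Type*} [Fintype β] {A : E → Matrix α β ℝ}
    {B : E → Matrix β κ ℝ} (hA : ∀ a b, ContDiffOn ℝ ∞ (fun x => A x a b) s)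
    (hB : ∀ a b, ContDiffOn ℝ ∞ (fun x => B x a b) s) (a : α) (c : κ) :
    ContDiffOn ℝ ∞ (fun x => (A x * B x) a c) s := by
  simp only [Matrix.mul_apply]
  exact ContDiffOn.sum fun b _ => (hA a b).mul (hB b c)

theorem contDiffOn_det {α : Type*} [Fintype α] [DecidableEq α] {A : E → Matrix α α ℝ}
    (hA : ∀ a b, ContDiffOn ℝ ∞ (fun x => A x a b) s) :
    ContDiffOn ℝ ∞ (fun x => (A x).det) s := by
  simp only [Matrix.det_apply']
  exact ContDiffOn.sum fun σ _ => contDiffOn_const.mul (contDiffOn_prod fun i _ => hA _ _)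

/-- Cramer's rule: the entries are cofactors divided by the nonvanishing determinant. -/
theorem contDiffOn_matrix_inv {α : Type*} [Fintype α] [DecidableEq α] {A : E → Matrix α α ℝ}
    (hA : ∀ a b, ContDiffOn ℝ ∞ (fun x => A x a b) s) (h : ∀ x ∈ s, (A x).det ≠ 0) (a b : α) :
    ContDiffOn ℝ ∞ (fun x => (A x)⁻¹ a b) s := by
  simp only [Matrix.inv_def, Matrix.smul_apply, Ring.inverse_eq_inv', smul_eq_mul,
    Matrix.adjugate_apply]
  refine ((contDiffOn_det hA).inv h).mul (contDiffOn_det fun c e => ?_)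
  by_cases hc : c = b
  · subst hc; simpa using contDiffOn_const
  · simpa [Matrix.updateRow_ne hc] using hA c e

theorem contDiff_matricizeOthers_entry (i : Fin d)
    (M : (j : Fin d) → Matrix (Fin (m j)) (Fin (n j)) ℝ) (a : Fin (n i)) (c : OtherIdx m i) :
    ContDiff ℝ ∞ fun Y : Tensor n => matricizeOthers i Y M a c := by
  simp only [matricizeOthers, Matrix.mul_apply, matricize, Matrix.of_apply]
  exact ContDiff.sum fun b _ => (contDiff_piLp_apply 2).mul contDiff_const

end Smoothness

/-! ### A local chart of the fixed-rank manifold. -/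

section Chart

open Matrix

variable {d : ℕ} {n r : Fin d → ℕ} {C : Tensor r}
  {U : (i : Fin d) → Matrix (Fin (n i)) (Fin (r i)) ℝ}

/-- A matrix whose columns span, for `Y` of multilinear rank `r` near `C ×₁ U₁ ⋯ ×_d U_d`, the
column space of `Y_(i)`. -/
def columnFrame (C : Tensor r) (U : (i : Fin d) → Matrix (Fin (n i)) (Fin (r i)) ℝ) (Y : Tensor n)
    (i : Fin d) : Matrix (Fin (n i)) (Fin (r i)) ℝ :=
  matricizeOthers i Y (fun j => (U j)ᵀ) * pinv (matricize i C)

/-- The basis of the column space of `Y_(i)` that is normalized by `U_iᵀ W_i = I`. -/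
def normalizedFrame (C : Tensor r) (U : (i : Fin d) → Matrix (Fin (n i)) (Fin (r i)) ℝ)
    (Y : Tensor n) (i : Fin d) : Matrix (Fin (n i)) (Fin (r i)) ℝ :=
  columnFrame C U Y i * ((U i)ᵀ * columnFrame C U Y i)⁻¹

/-- The domain of the chart around `C ×₁ U₁ ⋯ ×_d U_d`. -/
def chartDomain (C : Tensor r) (U : (i : Fin d) → Matrix (Fin (n i)) (Fin (r i)) ℝ) :
    Set (Tensor n) :=
  {Y | ∀ i, ((U i)ᵀ * columnFrame C U Y i).det ≠ 0}

theorem contDiff_columnFrame_entry (i : Fin d) (a : Fin (n i)) (b : Fin (r i)) :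
    ContDiff ℝ ∞ fun Y : Tensor n => columnFrame C U Y i a b := by
  rw [← contDiffOn_univ]
  exact contDiffOn_matrix_mul (A := fun Y : Tensor n => matricizeOthers i Y fun j => (U j)ᵀ)
    (B := fun _ => pinv (matricize i C))
    (fun _ _ => (contDiff_matricizeOthers_entry i _ _ _).contDiffOn)
    (fun _ _ => contDiffOn_const) a b

theorem contDiff_transpose_mul_columnFrame_entry (i : Fin d) (a b : Fin (r i)) :
    ContDiff ℝ ∞ fun Y : Tensor n => ((U i)ᵀ * columnFrame C U Y i) a b := by
  rw [← contDiffOn_univ]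
  exact contDiffOn_matrix_mul (A := fun _ : Tensor n => (U i)ᵀ) (B := fun Y => columnFrame C U Y i)
    (fun _ _ => contDiffOn_const) (fun a b => (contDiff_columnFrame_entry i a b).contDiffOn) a b

theorem isOpen_chartDomain : IsOpen (chartDomain C U) := by
  simp only [chartDomain, Set.ofPred_forall]
  refine isOpen_iInter_of_finite fun i => isOpen_ne_fun ?_ continuous_const
  have := contDiffOn_det (s := Set.univ) fun a b =>
    (contDiff_transpose_mul_columnFrame_entry (C := C) (U := U) i a b).contDiffOn
  exact (contDiffOn_univ.mp this).continuous

theorem contDiffOn_normalizedFrame (i : Fin d) (a : Fin (n i)) (b : Fin (r i)) :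
    ContDiffOn ℝ ∞ (fun Y : Tensor n => normalizedFrame C U Y i a b) (chartDomain C U) :=
  contDiffOn_matrix_mul (A := fun Y => columnFrame C U Y i)
    (B := fun Y => ((U i)ᵀ * columnFrame C U Y i)⁻¹)
    (fun a b => (contDiff_columnFrame_entry i a b).contDiffOn)
    (contDiffOn_matrix_inv (A := fun Y => (U i)ᵀ * columnFrame C U Y i)
      (fun a b => (contDiff_transpose_mul_columnFrame_entry i a b).contDiffOn)
      fun Y (hY : Y ∈ chartDomain C U) => hY i) a b

theorem transpose_mul_normalizedFrame {Y : Tensor n} (hY : Y ∈ chartDomain C U) (i : Fin d) :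
    (U i)ᵀ * normalizedFrame C U Y i = 1 := by
  rw [normalizedFrame, ← Matrix.mul_assoc, Matrix.mul_nonsing_inv _ (isUnit_iff_ne_zero.mpr (hY i))]

/-- If the columns of `A B` span those of `A`, an oblique projection onto them fixes `A`. -/
theorem mul_inv_mul_of_rank {α β κ : Type*} [Fintype α] [Fintype β] [Fintype κ] [DecidableEq κ]
    {A : Matrix α β ℝ} {B : Matrix β κ ℝ} {L : Matrix κ α ℝ} (hA : A.rank = Fintype.card κ)
    (h : (L * (A * B)).det ≠ 0) : A * B * (L * (A * B))⁻¹ * (L * A) = A := by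
  classical
  -- Invertibility of `L A B` forces the rank of `A B` up to that of `A`, so the column spaces
  -- coincide and `A` factors as `A B Z`.
  have hrank : (A * B).rank = A.rank := by
    refine le_antisymm (Matrix.rank_mul_le_left _ _) ?_
    rw [hA, ← Matrix.rank_of_isUnit _ ((Matrix.isUnit_iff_isUnit_det _).mpr
      (isUnit_iff_ne_zero.mpr h))]
    exact Matrix.rank_mul_le_right _ _
  have hrange : LinearMap.range (A * B).mulVecLin = LinearMap.range A.mulVecLin := by
    refine Submodule.eq_of_le_of_finrank_eq ?_ hrank
    rw [Matrix.mulVecLin_mul]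
    exact LinearMap.range_comp_le_range _ _
  have hcol : ∀ b, ∃ z, (A * B).mulVec z = A.col b := by
    intro b
    have : A.col b ∈ LinearMap.range A.mulVecLin :=
      ⟨Pi.single b 1, by simp⟩
    rw [← hrange] at this
    exact this
  choose z hz using hcol
  have hZ : A * B * (Matrix.of z)ᵀ = A := by
    ext a b
    exact congrFun (hz b) a
  calc A * B * (L * (A * B))⁻¹ * (L * A)
      = A * B * (L * (A * B))⁻¹ * (L * (A * B * (Matrix.of z)ᵀ)) := by rw [hZ]
    _ = A * B * ((L * (A * B))⁻¹ * (L * (A * B))) * (Matrix.of z)ᵀ := by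
        simp only [Matrix.mul_assoc]
    _ = A := by
        rw [Matrix.nonsing_inv_mul _ (isUnit_iff_ne_zero.mpr h), Matrix.mul_one, hZ]

theorem normalizedFrame_mul_matricize {Y : Tensor n} (hY : Y ∈ chartDomain C U)
    (hr : Y ∈ fixedRank n r) (i : Fin d) :
    normalizedFrame C U Y i * ((U i)ᵀ * matricize i Y) = matricize i Y := by
  have h := hY i
  rw [normalizedFrame]
  rw [columnFrame, matricizeOthers, Matrix.mul_assoc (matricize i Y)] at h ⊢
  exact mul_inv_mul_of_rank ((congrFun hr i).trans (by simp)) h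

/-- The modes can be switched on one at a time, and each single mode product fixes `Y`. -/
theorem multiProd_eq_self (Y : Tensor n) (N : (i : Fin d) → Matrix (Fin (n i)) (Fin (n i)) ℝ)
    (h : ∀ i, N i * matricize i Y = matricize i Y) : multiProd Y N = Y := by
  suffices key : ∀ S : Finset (Fin d), multiProd Y (fun i => if i ∈ S then N i else 1) = Y by
    simpa using key Finset.univ
  intro S
  induction S using Finset.induction_on with
  | empty => simpa using multiProd_one Y
  | insert k S hk ih =>
    have h1 : modeProd Y k (N k) = Y := matricize_injective k (by rw [matricize_modeProd, h k])
    conv_rhs => rw [← ih]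
    conv_rhs => rw [← h1, modeProd, multiProd_multiProd]
    congr 1
    funext j
    by_cases hj : j = k
    · subst hj; simp [hk]
    · simp [hj]

/-- Near `C ×₁ U₁ ⋯ ×_d U_d`, a tensor of multilinear rank `r` is recovered from its core and its
normalized column bases. -/
theorem multiProd_normalizedFrame {Y : Tensor n} (hY : Y ∈ chartDomain C U)
    (hr : Y ∈ fixedRank n r) :
    multiProd (multiProd Y fun i => (U i)ᵀ) (normalizedFrame C U Y) = Y := by
  rw [multiProd_multiProd]
  refine multiProd_eq_self Y _ fun i => ?_
  rw [Matrix.mul_assoc, normalizedFrame_mul_matricize hY hr]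

/-- Factoring through `V_i` bounds the rank above, and the invertible `r_i × r_i` matrix of the
chart bounds it below. Hence curves of products stay on the manifold while they stay in the open
chart domain. -/
theorem mem_fixedRank_of_mem_chartDomain {D : Tensor r}
    {V : (i : Fin d) → Matrix (Fin (n i)) (Fin (r i)) ℝ} (h : multiProd D V ∈ chartDomain C U) :
    multiProd D V ∈ fixedRank n r := by
  funext i
  refine le_antisymm ?_ ?_
  · rw [multilinearRank, matricize_multiProd]
    exact (Matrix.rank_mul_le_left _ _).trans ((Matrix.rank_le_card_width _).trans (by simp))
  · have h1 := Matrix.rank_of_isUnit _ ((Matrix.isUnit_iff_isUnit_det _).mpr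
      (isUnit_iff_ne_zero.mpr (h i)))
    rw [Fintype.card_fin] at h1
    rw [← h1, columnFrame, matricizeOthers, Matrix.mul_assoc]
    exact (Matrix.rank_mul_le_right _ _).trans (Matrix.rank_mul_le_left _ _)

end Chart

/-! ### Tangent spaces, smoothness of the tangent projection and the curvature formula. -/

section Tangent

open Matrix

variable {d : ℕ} {n r : Fin d → ℕ} {C : Tensor r}
  {U : (i : Fin d) → Matrix (Fin (n i)) (Fin (r i)) ℝ}

theorem hasDerivAt_add_smul_entry {α β : Type*} (A B : Matrix α β ℝ) (a : α) (b : β) (t : ℝ) :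
    HasDerivAt (fun s : ℝ => (A + s • B) a b) (B a b) t := by
  simpa using ((hasDerivAt_id t).mul_const (B a b)).const_add (A a b)

theorem hasDerivAt_add_smul {F : Type*} [NormedAddCommGroup F] [NormedSpace ℝ F] (A B : F) (t : ℝ) :
    HasDerivAt (fun s : ℝ => A + s • B) B t := by
  simpa using ((hasDerivAt_id t).smul_const B).const_add A

theorem contDiff_line (A D : Tensor r) (W V : (i : Fin d) → Matrix (Fin (n i)) (Fin (r i)) ℝ) :
    ContDiff ℝ ∞ fun t : ℝ => multiProd (A + t • D) (fun i => W i + t • V i) := by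
  rw [← contDiffOn_univ]
  refine contDiffOn_multiProd (ContDiff.contDiffOn (by fun_prop)) fun i a b => ?_
  simp only [Matrix.add_apply, Matrix.smul_apply, smul_eq_mul]
  exact ContDiff.contDiffOn (by fun_prop)

theorem hasDerivAt_line (A D : Tensor r) (W V : (i : Fin d) → Matrix (Fin (n i)) (Fin (r i)) ℝ) :
    HasDerivAt (fun t : ℝ => multiProd (A + t • D) (fun i => W i + t • V i))
      (variation A W D V) 0 := by
  have := hasDerivAt_multiProd (M := fun (t : ℝ) i => W i + t • V i) (hasDerivAt_add_smul A D 0)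
    fun i a b => hasDerivAt_add_smul_entry (W i) (V i) a b 0
  simpa only [zero_smul, add_zero] using this

/-- In the `i`-th summand the slot `i` holds the frozen `V_i`, so its velocity is `0`; likewise the
frozen core `D` has velocity `0`. -/
theorem hasDerivAt_variation_line (A A' D : Tensor r)
    (W W' V : (i : Fin d) → Matrix (Fin (n i)) (Fin (r i)) ℝ) :
    HasDerivAt (fun t : ℝ => variation (A + t • A') (fun i => W i + t • W' i) D V)
      (variation D W 0 W'
        + ∑ i, variation A (Function.update W i (V i)) A' (Function.update W' i 0)) 0 := by
  have h1 := hasDerivAt_multiProd (A := fun _ => D) (M := fun (t : ℝ) i => W i + t • W' i)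
    (hasDerivAt_const 0 D) fun i a b => hasDerivAt_add_smul_entry (W i) (W' i) a b 0
  have h2 : ∀ i, HasDerivAt (fun t : ℝ => multiProd (A + t • A')
      (Function.update (fun j => W j + t • W' j) i (V i)))
      (variation A (Function.update W i (V i)) A' (Function.update W' i 0)) 0 := by
    intro i
    have h := hasDerivAt_line A A' (Function.update W i (V i)) (Function.update W' i 0)
    convert! h using 3 with t
    funext j
    by_cases hj : j = i
    · subst hj; simp
    · simp [Function.update_of_ne hj]
  simp only [zero_smul, add_zero] at h1
  exact h1.add (HasDerivAt.fun_sum fun i _ => h2 i)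

theorem eventually_line_mem_chartDomain {A : Tensor r}
    {W : (i : Fin d) → Matrix (Fin (n i)) (Fin (r i)) ℝ} (h : multiProd A W ∈ chartDomain C U)
    (D : Tensor r) (V : (i : Fin d) → Matrix (Fin (n i)) (Fin (r i)) ℝ) :
    ∀ᶠ t in 𝓝 (0 : ℝ), multiProd (A + t • D) (fun i => W i + t • V i) ∈ chartDomain C U := by
  refine (contDiff_line A D W V).continuous.continuousAt.eventually_mem
    (isOpen_chartDomain.mem_nhds ?_)
  simpa only [zero_smul, add_zero] using h

theorem variation_mem_tangentSpace {A : Tensor r}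
    {W : (i : Fin d) → Matrix (Fin (n i)) (Fin (r i)) ℝ} (h : multiProd A W ∈ chartDomain C U)
    (D : Tensor r) (V : (i : Fin d) → Matrix (Fin (n i)) (Fin (r i)) ℝ) :
    variation A W D V ∈ tangentSpace (fixedRank n r) (multiProd A W) := by
  refine Submodule.subset_span ⟨_, contDiff_line A D W V, ?_, ?_, hasDerivAt_line A D W V⟩
  · exact (eventually_line_mem_chartDomain h D V).mono fun t ht =>
      mem_fixedRank_of_mem_chartDomain ht
  · simp only [zero_smul, add_zero]

/-- The tangent space of the manifold of tensors of multilinear rank `r`. -/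
theorem tangentSpace_eq_range {Y : Tensor n} (hY : Y ∈ chartDomain C U) (hr : Y ∈ fixedRank n r) :
    tangentSpace (fixedRank n r) Y
      = LinearMap.range
        (variationL (multiProd Y fun i => (U i)ᵀ) (normalizedFrame C U Y)) := by
  have hYeq := multiProd_normalizedFrame hY hr
  apply le_antisymm
  · refine Submodule.span_le.mpr ?_
    rintro v ⟨γ, -, hM, h0, hγ⟩
    have hcore : HasDerivAt (fun t => multiProd (γ t) fun i => (U i)ᵀ)
        (multiProd v fun i => (U i)ᵀ) 0 :=
      (LinearMap.toContinuousLinearMap (multiProdL fun i => (U i)ᵀ)).hasFDerivAt.comp_hasDerivAt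
        0 hγ
    have hnhds : chartDomain C U ∈ 𝓝 Y := isOpen_chartDomain.mem_nhds hY
    have hframe : ∀ i a b, HasDerivAt (fun t => normalizedFrame C U (γ t) i a b)
        (fderiv ℝ (fun Z => normalizedFrame C U Z i a b) Y v) 0 := fun i a b =>
      HasFDerivAt.comp_hasDerivAt_of_eq 0
        (((contDiffOn_normalizedFrame i a b).contDiffAt hnhds).differentiableAt
          (by simp)).hasFDerivAt hγ h0.symm
    have hder := hasDerivAt_multiProd (M := fun t => normalizedFrame C U (γ t))
      (M' := fun i => Matrix.of fun a b => fderiv ℝ (fun Z => normalizedFrame C U Z i a b) Y v)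
      hcore hframe
    -- The curve equals its own reconstruction from core and frames, so the product rule writes its
    -- velocity as a `variation`.
    have hev : γ =ᶠ[𝓝 0] fun t =>
        multiProd (multiProd (γ t) fun i => (U i)ᵀ) (normalizedFrame C U (γ t)) := by
      filter_upwards [hM, hγ.continuousAt.eventually_mem (h0 ▸ hnhds)] with t h1 h2
      exact (multiProd_normalizedFrame h2 h1).symm
    have hv := hγ.unique (hder.congr_of_eventuallyEq hev)
    rw [h0] at hv
    exact ⟨(_, _), hv.symm⟩
  · rintro _ ⟨v, rfl⟩
    have h := variation_mem_tangentSpace (hYeq.symm ▸ hY : multiProd (multiProd Y fun i => (U i)ᵀ)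
      (normalizedFrame C U Y) ∈ chartDomain C U) v.1 v.2
    rwa [hYeq] at h

theorem rank_matricize_core (hX : multiProd C U ∈ fixedRank n r) (i : Fin d) :
    (matricize i C).rank = r i := by
  refine le_antisymm ((Matrix.rank_le_card_height _).trans (by simp)) ?_
  have h : (matricize i (multiProd C U)).rank = r i := congrFun hX i
  rw [matricize_multiProd, matricizeOthers] at h
  exact h.symm.le.trans <| (Matrix.rank_mul_le_right _ _).trans (Matrix.rank_mul_le_left _ _)

/-- This explains the factor `C_(i)⁺` in `columnFrame`: it makes the frame at the base point equal
to `U_i`. -/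
theorem columnFrame_base (hU : ∀ i, (U i)ᵀ * U i = 1) (hC : ∀ i, (matricize i C).rank = r i)
    (i : Fin d) : columnFrame C U (multiProd C U) i = U i := by
  rw [columnFrame, matricizeOthers_multiProd, matricizeOthers_eq_matricize i C fun j _ => hU j,
    Matrix.mul_assoc, mul_pinv (by simp [hC i]), Matrix.mul_one]

theorem mem_chartDomain_base (hU : ∀ i, (U i)ᵀ * U i = 1) (hC : ∀ i, (matricize i C).rank = r i) :
    multiProd C U ∈ chartDomain C U := fun i => by
  rw [columnFrame_base hU hC, hU i, Matrix.det_one]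
  exact one_ne_zero

theorem normalizedFrame_base (hU : ∀ i, (U i)ᵀ * U i = 1)
    (hC : ∀ i, (matricize i C).rank = r i) : normalizedFrame C U (multiProd C U) = U := by
  funext i
  rw [normalizedFrame, columnFrame_base hU hC, hU i, inv_one, Matrix.mul_one]

theorem multiProd_transpose_base (hU : ∀ i, (U i)ᵀ * U i = 1) :
    multiProd (multiProd C U) (fun i => (U i)ᵀ) = C := by
  rw [multiProd_multiProd]
  simp only [hU, multiProd_one]

theorem tangentSpace_base (hU : ∀ i, (U i)ᵀ * U i = 1) (hX : multiProd C U ∈ fixedRank n r) :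
    tangentSpace (fixedRank n r) (multiProd C U) = LinearMap.range (variationL C U) := by
  have hC := rank_matricize_core hX
  rw [tangentSpace_eq_range (mem_chartDomain_base hU hC) hX, normalizedFrame_base hU hC,
    multiProd_transpose_base hU]

/-- The tangent projection in terms of a Tucker decomposition with orthonormal bases. -/
theorem tangentProj_base (hU : ∀ i, (U i)ᵀ * U i = 1) (hX : multiProd C U ∈ fixedRank n r)
    (E : Tensor n) :
    tangentProj (fixedRank n r) (multiProd C U) E = variationL C U (tangentCoord C U E) := by
  have hT := tangentSpace_base hU hX
  refine Submodule.eq_starProjection_of_mem_of_inner_eq_zero (hT ▸ ⟨_, rfl⟩) fun w hw => ?_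
  rw [hT] at hw
  obtain ⟨v, rfl⟩ := hw
  exact inner_sub_projection_variation hU (rank_matricize_core hX) E v.1 v.2

/-- The map from the tangent coordinates at `C ×₁ U₁ ⋯ ×_d U_d` to tangent vectors at `Y`. -/
def tangentTransport (C : Tensor r) (U : (i : Fin d) → Matrix (Fin (n i)) (Fin (r i)) ℝ)
    (Y : Tensor n) : Tensor n →L[ℝ] Tensor n :=
  LinearMap.toContinuousLinearMap
    ((variationL (multiProd Y fun i => (U i)ᵀ) (normalizedFrame C U Y)).comp (tangentCoord C U))

/-- `tangentCoord` only produces pairs with `U_iᵀ V_i = 0`. Nothing is lost: since `U_iᵀ W_i = 1`,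
subtracting `W_i (U_iᵀ V_i)` and moving it into the core achieves this gauge at `Y` as well. -/
theorem range_tangentTransport (hU : ∀ i, (U i)ᵀ * U i = 1)
    (hC : ∀ i, (matricize i C).rank = r i) {Y : Tensor n} (hY : Y ∈ chartDomain C U)
    (hr : Y ∈ fixedRank n r) :
    LinearMap.range (tangentTransport C U Y : Tensor n →ₗ[ℝ] Tensor n)
      = tangentSpace (fixedRank n r) Y := by
  rw [tangentSpace_eq_range hY hr]
  refine le_antisymm (LinearMap.range_comp_le_range _ _) ?_
  rintro _ ⟨⟨D, V⟩, rfl⟩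
  have hW := transpose_mul_normalizedFrame hY
  set W := normalizedFrame C U Y
  set A := multiProd Y fun i => (U i)ᵀ
  have hV : ∀ i, (U i)ᵀ * (V i - W i * ((U i)ᵀ * V i)) = 0 := fun i => by
    rw [Matrix.mul_sub, ← Matrix.mul_assoc, hW i, Matrix.one_mul, sub_self]
  refine ⟨variation C U (D + ∑ i, modeProd A i ((U i)ᵀ * V i))
    (fun i => V i - W i * ((U i)ᵀ * V i)), ?_⟩
  change variationL A W (tangentCoord C U _) = _
  rw [tangentCoord_variation hU hC _ hV]
  exact variation_gauge A W D V _

theorem contDiffOn_tangentTransport :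
    ContDiffOn ℝ ∞ (tangentTransport C U) (chartDomain C U) := by
  rw [contDiffOn_clm_apply]
  intro E
  refine contDiffOn_variation (contDiffOn_multiProd contDiffOn_id fun _ _ _ => contDiffOn_const)
    (fun i a b => contDiffOn_normalizedFrame i a b) contDiffOn_const
    fun _ _ _ => contDiffOn_const

/-- The tangent projection depends differentiably on the point of the manifold. -/
theorem differentiableWithinAt_tangentProj (hU : ∀ i, (U i)ᵀ * U i = 1)
    (hX : multiProd C U ∈ fixedRank n r) :
    DifferentiableWithinAt ℝ (tangentProj (fixedRank n r)) (fixedRank n r) (multiProd C U) := by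
  have hC := rank_matricize_core hX
  have hXO := mem_chartDomain_base hU hC
  have hnhds := isOpen_chartDomain.mem_nhds hXO
  set X := multiProd C U with hXdef
  set P := tangentProj (fixedRank n r) X with hP
  let S := tangentTransport C U
  have hSX : S X = P := by
    ext1 E
    rw [hP, hXdef, tangentProj_base hU hX]
    change variationL _ _ (tangentCoord C U E) = _
    rw [normalizedFrame_base hU hC, multiProd_transpose_base hU]
  have hPP : P * P = P := by
    ext1 E
    exact tangentProj_tangentProj _ _ E
  have hPadj : P.adjoint = P := by
    symm
    rw [ContinuousLinearMap.eq_adjoint_iff]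
    exact fun v w => inner_tangentProj _ _ v w
  have hSP : ∀ Y, S Y * P = S Y := fun Y => by
    ext1 E
    change variationL _ _ (tangentCoord C U (P E)) = variationL _ _ (tangentCoord C U E)
    rw [hP, hXdef, tangentProj_base hU hX, variationL_apply C U,
      tangentCoord_variation hU hC _ (transpose_mul_tangentCoord hU E)]
  have hPS : ∀ Y, P * (S Y).adjoint = (S Y).adjoint := fun Y => by
    conv_rhs => rw [← hSP Y]
    rw [← ContinuousLinearMap.star_eq_adjoint, ← ContinuousLinearMap.star_eq_adjoint, star_mul,
      ContinuousLinearMap.star_eq_adjoint P, hPadj]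
  -- `S† S` vanishes on the normal space at `X`; adding `1 - P` makes the operator the identity at
  -- `X`, hence invertible nearby.
  let A : Tensor n → (Tensor n →L[ℝ] Tensor n) := fun Y => (S Y).adjoint * S Y + (1 - P)
  have hS : DifferentiableAt ℝ S X :=
    (contDiffOn_tangentTransport.contDiffAt hnhds).differentiableAt (by simp)
  have hSadj : DifferentiableAt ℝ (fun Y => (S Y).adjoint) X := by
    simp only [← ContinuousLinearMap.star_eq_adjoint]
    exact hS.star
  have hA : DifferentiableAt ℝ A X := (hSadj.mul hS).add_const _
  have hAX : A X = 1 := by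
    simp only [A, hSX, hPadj, hPP]
    abel
  have hR : DifferentiableAt ℝ (fun Y => Ring.inverse (A Y)) X :=
    hA.inverse (hAX ▸ isUnit_one)
  have hunit : ∀ᶠ Y in 𝓝 X, IsUnit (A Y) :=
    hA.continuousAt.eventually_mem (Units.isOpen.mem_nhds (by
      rw [hAX]; exact isUnit_one))
  have hG : DifferentiableAt ℝ (fun Y => S Y * (Ring.inverse (A Y) * (S Y).adjoint)) X :=
    hS.mul (hR.mul hSadj)
  have hev : ∀ Y ∈ fixedRank n r, Y ∈ chartDomain C U → IsUnit (A Y) →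
      tangentProj (fixedRank n r) Y = S Y * (Ring.inverse (A Y) * (S Y).adjoint) :=
    fun Y hr hY hu => starProjection_range_eq (range_tangentTransport hU hC hY hr) (hPS Y) hPP
      (Ring.mul_inverse_cancel _ hu)
  refine hG.differentiableWithinAt.congr_of_eventuallyEq ?_
    (hev X hX hXO (hAX ▸ isUnit_one))
  filter_upwards [self_mem_nhdsWithin, mem_nhdsWithin_of_mem_nhds hnhds,
    mem_nhdsWithin_of_mem_nhds hunit] with Y h1 h2 h3 using hev Y h1 h2 h3

/-- The curvature term in terms of a Tucker decomposition with orthonormal bases. -/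
theorem tangentProj_fderivWithin_eq_variation (hU : ∀ i, (U i)ᵀ * U i = 1)
    (hX : multiProd C U ∈ fixedRank n r) (C' : Tensor r)
    {U' : (i : Fin d) → Matrix (Fin (n i)) (Fin (r i)) ℝ} (hU' : ∀ i, (U' i)ᵀ * U i = 0)
    (E : Tensor n) :
    tangentProj (fixedRank n r) (multiProd C U)
        (fderivWithin ℝ (tangentProj (fixedRank n r)) (fixedRank n r) (multiProd C U)
          (variation C U C' U') (E - tangentProj (fixedRank n r) (multiProd C U) E))
      = variation C U (curvatureCore C U U' E) (curvatureBasis C U C' U' E) := by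
  have hC := rank_matricize_core hX
  have hXO := mem_chartDomain_base hU hC
  have hT := tangentSpace_base hU hX
  have hmem : variation C U (curvatureCore C U U' E) (curvatureBasis C U C' U' E)
      ∈ tangentSpace (fixedRank n r) (multiProd C U) := variation_mem_tangentSpace hXO _ _
  have key : ∀ w ∈ tangentSpace (fixedRank n r) (multiProd C U),
      inner ℝ (tangentProj (fixedRank n r) (multiProd C U)
        (fderivWithin ℝ (tangentProj (fixedRank n r)) (fixedRank n r) (multiProd C U)
          (variation C U C' U') (E - tangentProj (fixedRank n r) (multiProd C U) E))) w
      = inner ℝ (variation C U (curvatureCore C U U' E) (curvatureBasis C U C' U' E)) w := by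
    intro w hw
    -- A tangent vector is its own projection, so `tangentCoord` supplies coordinates satisfying the
    -- gauge condition.
    obtain ⟨D, V, hV, rfl⟩ : ∃ (D : Tensor r)
        (V : (i : Fin d) → Matrix (Fin (n i)) (Fin (r i)) ℝ), (∀ i, (U i)ᵀ * V i = 0) ∧
        variation C U D V = w :=
      ⟨_, _, transpose_mul_tangentCoord hU w,
        (tangentProj_base hU hX w).symm.trans (tangentProj_of_mem hw)⟩
    have hη := hasDerivAt_variation_line C C' D U U' V
    have h := inner_tangentProj_fderivWithin (differentiableWithinAt_tangentProj hU hX)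
      (hasDerivAt_line C C' U U')
      ((eventually_line_mem_chartDomain hXO C' U').mono fun t ht =>
        mem_fixedRank_of_mem_chartDomain ht)
      (by simp only [zero_smul, add_zero]) hη
      ((eventually_line_mem_chartDomain hXO C' U').mono fun t ht =>
        variation_mem_tangentSpace ht D V) E
    simp only [zero_smul, add_zero] at h
    rw [h, inner_variation_curvature hU hC C' D hU' hV, tangentProj_base hU hX]
  -- The difference of the two sides is itself tangent, so it may be used as the test vector.
  rw [← sub_eq_zero, ← inner_self_eq_zero (𝕜 := ℝ), inner_sub_left, sub_eq_zero]
  exact key _ (Submodule.sub_mem _ (tangentProj_mem _ _ _) hmem)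

end Tangent

/-! ### The gradient of the completion cost. -/

section Cost

variable {d : ℕ} {n : Fin d → ℕ}

/-- The chain rule gives the gradient `P† (P Y - P A)`; symmetry and idempotence of `P` remove the
outer factor. -/
theorem hasFDerivAt_completionCost {P : Tensor n →ₗ[ℝ] Tensor n} (hP : P.IsSymmetricProjection)
    (A Y : Tensor n) : HasFDerivAt (completionCost P A) (innerSL ℝ (P Y - P A)) Y := by
  have h1 : HasFDerivAt (fun Z => P Z - P A) (LinearMap.toContinuousLinearMap P) Y :=
    (LinearMap.toContinuousLinearMap P).hasFDerivAt.sub_const _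
  have h2 := (h1.norm_sq).const_mul (1 / 2 : ℝ)
  convert! h2 using 1
  ext v
  have h3 : P (P Y - P A) = P Y - P A := by
    rw [map_sub, ← Module.End.mul_apply, ← Module.End.mul_apply, hP.isIdempotentElem.eq]
  have h4 := hP.isSymmetric (P Y - P A) v
  rw [h3] at h4
  simpa [← inner_sub_left] using h4

end Cost

end LowRankTucker

end

open LowRankTucker
theorem corollary3p5 {d : ℕ} {n r : Fin d → ℕ} (C : Tensor r)
    (U : (i : Fin d) → Matrix (Fin (n i)) (Fin (r i)) ℝ)
    (hU : ∀ i, (U i).transpose * U i = 1)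
    (X : Tensor n) (hXC : X = multiProd C U) (hX : X ∈ fixedRank n r) :
    -- the operator-valued map `Y ↦ P_Y` is differentiable at `X` along `M_r`
    DifferentiableWithinAt ℝ (tangentProj (fixedRank n r)) (fixedRank n r) X ∧
    -- the curvature term
    (∀ (C' : Tensor r) (U' : (i : Fin d) → Matrix (Fin (n i)) (Fin (r i)) ℝ),
      (∀ i, (U' i).transpose * U i = 0) →
      ∀ ξ : Tensor n, ξ = variation C U C' U' →
      ξ ∈ tangentSpace (fixedRank n r) X ∧
      ∀ E : Tensor n,
        tangentProj (fixedRank n r) X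
            (fderivWithin ℝ (tangentProj (fixedRank n r)) (fixedRank n r) X ξ
              (E - tangentProj (fixedRank n r) X E))
          = variation C U (curvatureCore C U U' E) (curvatureBasis C U C' U' E) ∧
        variation C U (curvatureCore C U U' E) (curvatureBasis C U C' U' E)
          ∈ tangentSpace (fixedRank n r) X) ∧
    -- the Riemannian Hessian of the tensor completion cost
    (∀ (P : Tensor n →ₗ[ℝ] Tensor n), P.IsSymmetricProjection → ∀ A : Tensor n,
      DifferentiableWithinAt ℝ (completionCost P A) (fixedRank n r) X ∧
      DifferentiableWithinAt ℝ (riemGrad (fixedRank n r) (completionCost P A)) (fixedRank n r) X ∧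
      ∀ ξ ∈ tangentSpace (fixedRank n r) X,
        riemHess (fixedRank n r) (completionCost P A) X ξ
          = tangentProj (fixedRank n r) X (P ξ)
            + tangentProj (fixedRank n r) X
                (fderivWithin ℝ (tangentProj (fixedRank n r)) (fixedRank n r) X ξ
                  ((P X - P A) - tangentProj (fixedRank n r) X (P X - P A)))) := by
  subst hXC
  have hdiff := differentiableWithinAt_tangentProj hU hX
  have hXO := mem_chartDomain_base hU (rank_matricize_core hX)
  refine ⟨hdiff, ?_, ?_⟩
  · rintro C' U' hU' ξ rfl
    exact ⟨variation_mem_tangentSpace hXO C' U', fun E =>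
      ⟨tangentProj_fderivWithin_eq_variation hU hX C' hU' E, variation_mem_tangentSpace hXO _ _⟩⟩
  · intro P hP A
    have hcost := fun Y => hasFDerivAt_completionCost hP A Y
    have hgrad : riemGrad (fixedRank n r) (completionCost P A)
        = fun Y => tangentProj (fixedRank n r) Y (P Y - P A) :=
      funext fun Y => riemGrad_eq (hcost Y)
    have hg : HasFDerivWithinAt (fun Y => P Y - P A) (LinearMap.toContinuousLinearMap P)
        (fixedRank n r) (multiProd C U) :=
      (LinearMap.toContinuousLinearMap P).hasFDerivWithinAt.sub_const _
    have hder := hdiff.hasFDerivWithinAt.clm_apply hg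
    rw [← hgrad] at hder
    refine ⟨(hcost _).differentiableAt.differentiableWithinAt, hder.differentiableWithinAt, ?_⟩
    intro ξ hξ
    rw [riemHess, fderivWithin_eq_on_tangentSpace hder hξ]
    -- The product rule yields the full ambient gradient in the curvature term; its tangential part
    -- contributes nothing, so only the normal part remains.
    have h0 := tangentProj_fderivWithin_tangentProj hdiff hξ (P (multiProd C U) - P A)
    generalize P (multiProd C U) - P A = b at h0 ⊢
    rw [add_apply, ContinuousLinearMap.comp_apply, ContinuousLinearMap.flip_apply, map_add,
      tangentProj_tangentProj, map_sub _ b, map_sub, h0, sub_zero]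
    rfl
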